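/- Let $p$ be a prime and $G$ a (possibly infinite) group. A finite $p$-subgroup $S$ of a group $H$ is a Sylow $p$-subgroup of $H$ if every finite $p$-subgroup of $H$ is $H$-conjugate to a subgroup of $S$. The group $G$ is pseudo finite at $p$ if for every chain $P_0\le\dots\le P_n$ ($n\ge 0$) of finite $p$-subgroups of $G$ (trivial subgroup allowed), the group $\bigcap_i N_G(P_i)$ has a Sylow $p$-subgroup. For a collection $\mathcal C$ of subgroups of $G$ closed under conjugation, $N(\mathcal C)$ is the nerve of the poset $(\mathcal C,\subseteq)$ and $N(\mathcal C)/G$ is the simplicial set whose $n$-simplices are the orbits $[P_0,\dots,P_n]$ of the conjugation action on $n$-simplices. A Morse matching on a simplicial set $X$ consists of: a partition of the nondegenerate simplices (cells) into critical, redundant and collapsible cells; a bijection $c$ from the redundant to the collapsible cells sending $n$-cells to $(n+1)$-cells; and for each redundant $n$-cell $\tau$ an index $\iota(\tau)\in\{0,\dots,n+1\}$ with $d_{\iota(\tau)}(c(\tau))=\tau$; such that there is no infinite directed path in the digraph whose vertices are the redundant and collapsible cells and whose edges are $\tau\to c(\tau)$ for $\tau$ redundant and $\sigma\to d_j(\sigma)$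 for $\sigma$ collapsible, $j\ne\iota(c^{-1}(\sigma))$ and $d_j(\sigma)$ redundant or collapsible. **Theorem.** Suppose $G$ is pseudo finite at $p$, and let $\mathcal C$ be a nonempty collection of nontrivial finite $p$-subgroups of $G$ that is closed under $G$-conjugation and under passage to overgroups in $G$ that are finite $p$-groups. Then $G$ has a Sylow $p$-subgroup, and $N(\mathcal C)/G$ admits a Morse matching with exactly one critical cell, which is the $0$-cell $[S]$ for any Sylow $p$-subgroup $S$ of $G$ (every such $S$ lies in $\mathcal C$). Moreover the geometric realization of $N(\mathcal C)/G$ is contractible. Every finite group is pseudo finite at $p$, so this applies in particular to every finite group $G$ (Symonds' theorem). -/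

import Mathlib

open CategoryTheory Opposite
open scoped Simplicial Pointwise

universe u

/-! ### Sylow subgroups and pseudo finite groups -/

section Groups

/-- A finite `p`-subgroup `S` of a (possibly infinite) group `G` is a *Sylow `p`-subgroup* if every
finite `p`-subgroup of `G` is conjugate in `G` to a subgroup of `S`. -/
structure IsSylowSubgroup (p : ℕ) {G : Type u} [Group G] (S : Subgroup G) : Prop where
  finite : Finite S
  isPGroup : IsPGroup p S
  conj_le : ∀ P : Subgroup G, Finite P → IsPGroup p P → ∃ g : G, MulAut.conj g • P ≤ S

/-- The normalizer of a chain: the intersection of the normalizers of its members. -/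
def chainNormalizer {G : Type u} [Group G] {n : ℕ} (P : Fin (n + 1) → Subgroup G) : Subgroup G :=
  ⨅ i, Subgroup.normalizer (P i : Set G)

/-- `G` is *pseudo finite at `p`* if the normalizer of every chain `P₀ ≤ ⋯ ≤ Pₙ` of finite
`p`-subgroups of `G` (the trivial subgroup is allowed) has a Sylow `p`-subgroup. -/
def IsPseudoFinite (p : ℕ) (G : Type u) [Group G] : Prop :=
  ∀ (n : ℕ) (P : Fin (n + 1) → Subgroup G), Monotone P →
    (∀ i, Finite (P i) ∧ IsPGroup p (P i)) →
      ∃ S : Subgroup (chainNormalizer P), IsSylowSubgroup p S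

/-- A collection of nontrivial finite `p`-subgroups of `G` that is closed under conjugation and
under passage to finite `p`-overgroups. -/
structure IsClosedCollection (p : ℕ) {G : Type u} [Group G] (C : Set (Subgroup G)) : Prop where
  ne_bot : ∀ P ∈ C, P ≠ ⊥
  finite : ∀ P ∈ C, Finite P
  isPGroup : ∀ P ∈ C, IsPGroup p P
  conj_mem : ∀ P ∈ C, ∀ g : G, MulAut.conj g • P ∈ C
  overgroup_mem : ∀ P ∈ C, ∀ Q : Subgroup G, P ≤ Q → Finite Q → IsPGroup p Q → Q ∈ C

end Groups

/-! ### Quotient of a simplicial set by a group action -/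

namespace SSet

variable {G : Type u} [Group G] {X : SSet.{u}} (ρ : G →* End X)

/-- Two simplices in the same degree are equivalent if they lie in one orbit of the simplicial
action `ρ` of `G` on `X`. -/
def orbitSetoid (Δ : SimplexCategoryᵒᵖ) : Setoid (X.obj Δ) where
  r x y := ∃ g : G, (End.asHom (ρ g)).app Δ x = y
  iseqv :=
    { refl := fun x ↦ ⟨1, by rw [map_one]; rfl⟩
      symm := by
        rintro x _ ⟨g, rfl⟩
        refine ⟨g⁻¹, ?_⟩
        change (End.asHom (ρ g⁻¹ * ρ g)).app Δ x = x
        rw [← map_mul, inv_mul_cancel, map_one]; rfl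
      trans := by
        rintro x _ _ ⟨g, rfl⟩ ⟨h, rfl⟩
        exact ⟨h * g, by rw [map_mul]; rfl⟩ }

/-- The quotient simplicial set `X / G`, whose `n`-simplices are the `G`-orbits of `n`-simplices
of `X`. -/
def orbit : SSet.{u} where
  obj Δ := Quotient (orbitSetoid ρ Δ)
  map {Δ Δ'} f := TypeCat.ofHom (Quotient.map (X.map f) (by
    rintro x _ ⟨g, rfl⟩
    exact ⟨g, NatTrans.naturality_apply (End.asHom (ρ g)) f x⟩))
  map_id Δ := by
    ext x
    induction x using Quotient.inductionOn with
    | _ x => exact congrArg _ (Functor.map_id_apply X _ x)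
  map_comp f g := by
    ext x
    induction x using Quotient.inductionOn with
    | _ x => exact congrArg _ (Functor.map_comp_apply X f g x)

/-- The orbit of a simplex. -/
def orbitMk {Δ : SimplexCategoryᵒᵖ} (x : X.obj Δ) : (orbit ρ).obj Δ :=
  Quotient.mk (orbitSetoid ρ Δ) x

end SSet

/-! ### The orbit space of a collection of subgroups -/

section Collection

variable {G : Type u} [Group G] (C : Set (Subgroup G))
  (hC : ∀ P ∈ C, ∀ g : G, MulAut.conj g • P ∈ C)

/-- Conjugation by `g`, `P ↦ g P g⁻¹`, as an endofunctor of the poset `C`. -/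
def conjFunctor (g : G) : C ⥤ C :=
  Monotone.functor (f := fun P : C ↦ (⟨MulAut.conj g • P.1, hC P.1 P.2 g⟩ : C))
    (fun _ _ h ↦ Subgroup.map_mono h)

/-- The simplicial action of `G` by conjugation on the nerve `N(C)` of the poset `C`. -/
def conjAction : G →* End (nerve C) where
  toFun g := nerveMap (conjFunctor C hC g)
  map_one' := by
    apply SSet.hom_ext
    intro Δ
    apply ConcreteCategory.hom_ext
    intro x
    apply nerve.ext_of_isThin
    funext i
    apply Subtype.ext
    change MulAut.conj (1 : G) • (x.obj i).1 = (x.obj i).1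
    rw [map_one, one_smul]
  map_mul' g h := by
    apply SSet.hom_ext
    intro Δ
    apply ConcreteCategory.hom_ext
    intro x
    apply nerve.ext_of_isThin
    funext i
    apply Subtype.ext
    change MulAut.conj (g * h) • (x.obj i).1 = MulAut.conj g • MulAut.conj h • (x.obj i).1
    rw [map_mul, mul_smul]

/-- The simplicial set `N(C)/G`. -/
def orbitNerve : SSet.{u} := SSet.orbit (conjAction C hC)

/-- The vertex `[P]` of `N(C)/G` given by the conjugacy class of `P ∈ C`. -/
def orbitVertex (P : C) : orbitNerve C hC _⦋0⦌ :=
  SSet.orbitMk (conjAction C hC) (Δ := op ⦋0⦌) (nerveEquiv.symm P)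

end Collection

/-! ### Morse matchings -/

namespace SSet

/-- The combinatorial data underlying a Morse matching on a simplicial set `X`. -/
structure MatchingData (X : SSet.{u}) where
  /-- the critical `n`-cells -/
  critical (n : ℕ) : Set (X _⦋n⦌)
  /-- the redundant `n`-cells -/
  redundant (n : ℕ) : Set (X _⦋n⦌)
  /-- the collapsible `n`-cells -/
  collapsible (n : ℕ) : Set (X _⦋n⦌)
  union_eq (n : ℕ) : critical n ∪ redundant n ∪ collapsible n = X.nonDegenerate n
  disjoint_critical_redundant (n : ℕ) : Disjoint (critical n) (redundant n)
  disjoint_critical_collapsible (n : ℕ) : Disjoint (critical n) (collapsible n)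
  disjoint_redundant_collapsible (n : ℕ) : Disjoint (redundant n) (collapsible n)
  /-- the bijection from redundant cells to collapsible cells; it raises dimension by one, so it
  restricts to bijections in each degree and there is no collapsible `0`-cell -/
  c (n : ℕ) : redundant n ≃ collapsible (n + 1)
  collapsible_zero : collapsible 0 = ∅
  /-- the index of the face of `c τ` that is `τ` -/
  ι (n : ℕ) : redundant n → Fin (n + 2)
  δ_ι (n : ℕ) (τ : redundant n) : X.δ (ι n τ) (c n τ : X _⦋n + 1⦌) = (τ : X _⦋n⦌)

/-- The edges of the digraph of a matching: `τ ⟶ c τ` for `τ` redundant, and `σ ⟶ d_j σ` for `σ`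
collapsible and `j ≠ ι (c⁻¹ σ)`, whenever `d_j σ` is again a vertex, that is, a redundant or
collapsible cell. -/
inductive MatchingData.Edge {X : SSet.{u}} (M : MatchingData X) :
    ((n : ℕ) × X _⦋n⦌) → ((n : ℕ) × X _⦋n⦌) → Prop where
  /-- a redundant cell points to its collapsible partner -/
  | up {n : ℕ} (τ : M.redundant n) : M.Edge ⟨n, τ⟩ ⟨n + 1, M.c n τ⟩
  /-- a collapsible cell points to its other redundant or collapsible faces -/
  | down {n : ℕ} (σ : M.collapsible (n + 1)) (j : Fin (n + 2))
      (hj : j ≠ M.ι n ((M.c n).symm σ))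
      (hmem : X.δ j (σ : X _⦋n + 1⦌) ∈ M.redundant n ∪ M.collapsible n) :
      M.Edge ⟨n + 1, σ⟩ ⟨n, X.δ j (σ : X _⦋n + 1⦌)⟩

/-- A *Morse matching* on `X`: matching data whose digraph has no infinite directed path. -/
structure MorseMatching (X : SSet.{u}) extends MatchingData X where
  no_infinite_path :
    ¬ ∃ f : ℕ → ((n : ℕ) × X _⦋n⦌), ∀ k, toMatchingData.Edge (f k) (f (k + 1))

end SSet

/-!
The simplices of `N(C)/G` are the conjugacy classes of chains, that is, of nonempty finite totally
ordered sets `s ⊆ C`. Let `normalPart s` be the longest initial segment of `s` whose members are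
normal in its last member `normalTop s`, and let `chainStabilizer s` be the intersection of the
normalizers of the members of the normal part with all other members of `s`. It contains
`normalTop s` and normalizes every member of `s`. Since `G` is pseudo finite at `p`, it has a Sylow
`p`-subgroup `R`: either `s` is its own normal part, or the stabilizer is a finite `p`-group. The
chain is *full* if `R = normalTop s`. If it is not full, its partner is `insert R s`, a full chain
with `normalTop (insert R s) = R` (`IsPChain.normalTop_insert`, `IsPChain.isFull_insert`).
Sylow subgroups of the stabilizer are conjugate by elements fixing all members of `s`, so the
partner is well defined on conjugacy classes. It is inverted by removing `normalTop` from a full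
chain of at least two members. That this gives a chain which is not full, with the removed member as
a Sylow subgroup of its stabilizer, follows from the fact that normalizers grow in finite
`p`-groups (`IsPChain.normalPart_erase`, `IsPChain.isSylowIn_erase`). The same fact shows that a
chain with one member is full exactly if this member is a Sylow subgroup of `G`, which leaves one
critical cell.

There are no infinite paths because the order of `normalTop` strictly increases from a redundant
cell to its partner, does not decrease along the other faces of the partner
(`IsSylowIn.le_normalTop_erase_insert`), and is bounded by the order of a Sylow subgroup of `G`,
while a step down to a collapsible face lowers the dimension for good
(`IsClosedCollection.edgeRank_lt`).

For contractibility, a Morse matching whose only critical cell is a vertex is turned into a regular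
pairing of the remaining cells, so that the inclusion of the vertex is an anodyne extension
(`SSet.MorseMatching.contractibleSpace`). The path fibration `γ ↦ (γ 0, γ 1)` of a space `Y` becomes
a Kan fibration of singular simplicial sets, because the prism over a simplex retracts onto the
prism over a horn together with the two ends (`TopCat.endpoints_mem_fibrations`). With `Y` the
realization, lifting the map `x ↦ (x, x₀)` along the path fibration produces a contraction
(`SSet.contractibleSpace_of_anodyne`).
-/

/-! ### Retracting the prism over a simplex -/

namespace stdSimplex

variable {n : ℕ} (i : Fin (n + 2))

/-- The union of the faces of the topological simplex opposite to the vertices `j ≠ i`. -/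
def hornSet : Set (stdSimplex ℝ (Fin (n + 2))) := {x | ∃ j ≠ i, x j = 0}

/-- The prism over the horn together with the bottom and the top of the cylinder. -/
def hornPrism : Set (stdSimplex ℝ (Fin (n + 2)) × unitInterval) :=
  {q | q.1 ∈ hornSet i ∨ q.2 = 0 ∨ q.2 = 1}

lemma erase_nonempty : (Finset.univ.erase i).Nonempty := by
  obtain ⟨j, hj⟩ := exists_ne i
  exact ⟨j, by simpa using hj⟩

/-- The distance to the horn, measured by the smallest coordinate different from the `i`-th. -/
noncomputable def hornHeight (x : stdSimplex ℝ (Fin (n + 2))) : ℝ :=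
  (Finset.univ.erase i).inf' (erase_nonempty i) (fun j ↦ x j)

@[fun_prop]
lemma continuous_apply' (j : Fin (n + 2)) :
    Continuous (fun x : stdSimplex ℝ (Fin (n + 2)) ↦ x j) :=
  (continuous_apply j).comp continuous_subtype_val

@[fun_prop]
lemma continuous_hornHeight : Continuous (hornHeight i) := by
  unfold hornHeight
  exact Continuous.finset_inf'_apply _ fun j _ ↦ continuous_apply' j

lemma hornHeight_le {x : stdSimplex ℝ (Fin (n + 2))} {j : Fin (n + 2)} (hj : j ≠ i) :
    hornHeight i x ≤ x j :=
  Finset.inf'_le _ (by simpa using hj)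

lemma exists_hornHeight_eq (x : stdSimplex ℝ (Fin (n + 2))) :
    ∃ j ≠ i, x j = hornHeight i x := by
  obtain ⟨j, hj, h⟩ := Finset.exists_mem_eq_inf' (erase_nonempty i) (fun j ↦ x j)
  exact ⟨j, by simpa using hj, h.symm⟩

lemma hornHeight_nonneg (x : stdSimplex ℝ (Fin (n + 2))) : 0 ≤ hornHeight i x := by
  obtain ⟨j, _, h⟩ := exists_hornHeight_eq i x
  exact h ▸ zero_le x j

lemma hornHeight_le_one (x : stdSimplex ℝ (Fin (n + 2))) : hornHeight i x ≤ 1 := by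
  obtain ⟨j, _, h⟩ := exists_hornHeight_eq i x
  exact h ▸ le_one x j

lemma hornHeight_eq_zero {x : stdSimplex ℝ (Fin (n + 2))} (hx : x ∈ hornSet i) :
    hornHeight i x = 0 := by
  obtain ⟨j, hj, h⟩ := hx
  exact le_antisymm (h ▸ hornHeight_le i hj) (hornHeight_nonneg i x)

/-- Moving a point of the simplex towards the `i`-th vertex by lowering every other coordinate
by `s`. -/
def push (x : stdSimplex ℝ (Fin (n + 2))) (s : ℝ) (h₀ : 0 ≤ s) (h : s ≤ hornHeight i x) :
    stdSimplex ℝ (Fin (n + 2)) :=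
  ⟨fun j ↦ x j + if j = i then (n + 1) * s else - s, by
    constructor
    · intro j
      dsimp only
      split_ifs with hj
      · have := zero_le x j
        positivity
      · have := hornHeight_le i (x := x) hj
        linarith
    · rw [Finset.sum_add_distrib, sum_eq_one, ← Finset.add_sum_erase _ _ (Finset.mem_univ i),
        Finset.sum_congr rfl (g := fun _ ↦ - s)
          (fun j hj ↦ if_neg (by simpa using hj))]
      simp [Finset.card_erase_of_mem]⟩

/-- The scaling factor of the central projection of the rectangle `[0, 1] × [-1, 1]`, with
centre `(2, 0)`, onto the union of its three sides other than the one nearest to the centre. -/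
noncomputable def projScale (s t : ℝ) : ℝ := (max ((2 - s) / 2) (abs (2 * t - 1)))⁻¹

section projScale

variable {s t : ℝ}

lemma projScale_pos (hs : s ≤ 1) : 0 < projScale s t :=
  inv_pos.2 (lt_max_of_lt_left (by linarith))

lemma projScale_mul (hs : s ≤ 1) : projScale s t * max ((2 - s) / 2) (abs (2 * t - 1)) = 1 :=
  inv_mul_cancel₀ (lt_max_of_lt_left (by linarith)).ne'

lemma one_le_projScale (hs₀ : 0 ≤ s) (hs : s ≤ 1) (ht₀ : 0 ≤ t) (ht : t ≤ 1) :
    1 ≤ projScale s t := by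
  refine (one_le_inv₀ (lt_max_of_lt_left (by linarith))).2 (max_le (by linarith) ?_)
  exact abs_le.2 ⟨by linarith, by linarith⟩

lemma projScale_mul_le (hs : s ≤ 1) : projScale s t * (2 - s) ≤ 2 := by
  have := mul_le_mul_of_nonneg_left (le_max_left ((2 - s) / 2) (abs (2 * t - 1)))
    (projScale_pos (t := t) hs).le
  rw [projScale_mul hs] at this
  linarith

lemma abs_projScale_mul_le (hs : s ≤ 1) : abs (projScale s t * (2 * t - 1)) ≤ 1 := by
  have := mul_le_mul_of_nonneg_left (le_max_right ((2 - s) / 2) (abs (2 * t - 1)))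
    (projScale_pos (t := t) hs).le
  rwa [projScale_mul hs, ← abs_of_pos (projScale_pos (t := t) hs), ← abs_mul] at this

lemma projScale_eq (hs : s ≤ 1) :
    projScale s t * (2 - s) = 2 ∨ projScale s t * (2 * t - 1) = 1 ∨
      projScale s t * (2 * t - 1) = -1 := by
  have h := projScale_mul (t := t) hs
  rcases max_choice ((2 - s) / 2) (abs (2 * t - 1)) with h' | h' <;> rw [h'] at h
  · left; linarith
  · right
    rcases abs_choice (2 * t - 1) with h'' | h'' <;> rw [h''] at h
    · exact Or.inl h
    · right; linarith

end projScale

/-- The retraction of the prism over the simplex onto `hornPrism i`: on each of the segments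
parallel to the line through the `i`-th vertex and the barycentre of the opposite face, it is the
central projection of `projScale`. -/
noncomputable def prismRetraction (q : stdSimplex ℝ (Fin (n + 2)) × unitInterval) :
    stdSimplex ℝ (Fin (n + 2)) × unitInterval :=
  ⟨push i q.1 (hornHeight i q.1 - (2 - projScale (hornHeight i q.1) q.2 * (2 - hornHeight i q.1)))
    (by
      have h₁ := one_le_projScale (hornHeight_nonneg i q.1) (hornHeight_le_one i q.1) q.2.2.1
        q.2.2.2
      have h₂ := hornHeight_le_one i q.1
      nlinarith)
    (by
      have := projScale_mul_le (t := q.2) (hornHeight_le_one i q.1)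
      linarith),
  ⟨(projScale (hornHeight i q.1) q.2 * (2 * q.2 - 1) + 1) / 2, by
    have := abs_le.1 (abs_projScale_mul_le (t := q.2) (hornHeight_le_one i q.1))
    constructor <;> linarith⟩⟩

lemma prismRetraction_fst_apply (q : stdSimplex ℝ (Fin (n + 2)) × unitInterval)
    (j : Fin (n + 2)) : (prismRetraction i q).1 j = q.1 j + if j = i
      then (n + 1) * (hornHeight i q.1 -
        (2 - projScale (hornHeight i q.1) q.2 * (2 - hornHeight i q.1)))
      else -(hornHeight i q.1 -
        (2 - projScale (hornHeight i q.1) q.2 * (2 - hornHeight i q.1))) := rfl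

lemma continuous_prismRetraction : Continuous (prismRetraction i) := by
  have h : Continuous fun q : stdSimplex ℝ (Fin (n + 2)) × unitInterval ↦
      projScale (hornHeight i q.1) q.2 := by
    unfold projScale
    refine Continuous.inv₀ (by fun_prop) fun q ↦ ?_
    have := hornHeight_le_one i q.1
    exact (lt_max_of_lt_left (by linarith)).ne'
  refine Continuous.prodMk (Continuous.subtype_mk (continuous_pi fun j ↦ ?_) _)
    (Continuous.subtype_mk (by fun_prop) _)
  have h' : Continuous fun q : stdSimplex ℝ (Fin (n + 2)) × unitInterval ↦ q.1 j :=
    (continuous_apply' j).comp continuous_fst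
  refine h'.add ?_
  by_cases hj : j = i
  · simp only [if_pos hj]; fun_prop
  · simp only [if_neg hj]; fun_prop

lemma prismRetraction_mem (q : stdSimplex ℝ (Fin (n + 2)) × unitInterval) :
    prismRetraction i q ∈ hornPrism i := by
  rcases projScale_eq (t := q.2) (hornHeight_le_one i q.1) with h | h | h
  · left
    obtain ⟨j, hj, hj'⟩ := exists_hornHeight_eq i q.1
    refine ⟨j, hj, ?_⟩
    rw [prismRetraction_fst_apply, if_neg hj, hj', h]
    ring
  · right; right
    ext
    change (_ + 1) / 2 = (1 : ℝ)
    rw [h]; norm_num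
  · right; left
    ext
    change (_ + 1) / 2 = (0 : ℝ)
    rw [h]; norm_num

lemma prismRetraction_eq {q : stdSimplex ℝ (Fin (n + 2)) × unitInterval} (hq : q ∈ hornPrism i) :
    prismRetraction i q = q := by
  have h₁ : projScale (hornHeight i q.1) q.2 = 1 := by
    have h₀ := hornHeight_nonneg i q.1
    have h₂ := hornHeight_le_one i q.1
    unfold projScale
    rw [inv_eq_one]
    rcases hq with h | h | h
    · have : abs (2 * (q.2 : ℝ) - 1) ≤ 1 :=
        abs_le.2 ⟨by linarith [q.2.2.1], by linarith [q.2.2.2]⟩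
      rw [hornHeight_eq_zero i h]
      simpa using this
    · rw [h]
      simp only [Set.Icc.coe_zero]
      norm_num
      linarith
    · rw [h]
      simp only [Set.Icc.coe_one]
      norm_num
      linarith
  refine Prod.ext (stdSimplex.ext (funext fun j ↦ ?_)) (Subtype.ext ?_)
  · rw [prismRetraction_fst_apply, h₁]
    simp
  · change (_ + 1) / 2 = _
    rw [h₁]
    ring

/-- A function that is continuous on `hornPrism i` extends to the whole prism. -/
lemma exists_continuous_extension {Y : Type*} [TopologicalSpace Y]
    (F : stdSimplex ℝ (Fin (n + 2)) × unitInterval → Y) (hF : ContinuousOn F (hornPrism i)) :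
    ∃ F' : C(stdSimplex ℝ (Fin (n + 2)) × unitInterval, Y), Set.EqOn F' F (hornPrism i) :=
  ⟨⟨F ∘ prismRetraction i, hF.comp_continuous (continuous_prismRetraction i)
    (prismRetraction_mem i)⟩, fun _ hq ↦ congrArg F (prismRetraction_eq i hq)⟩

end stdSimplex

/-! ### The path fibration and its lifting properties -/

namespace stdSimplex

lemma map_eq_self {n : ℕ} (e : Fin (n + 2) → Fin (n + 2))
    (z : stdSimplex ℝ (Fin (n + 2))) (h : ∀ j, z j ≠ 0 → e j = j) : map e z = z := by
  ext j
  rw [map_coe, FunOnFinite.linearMap_apply_apply, Finset.sum_filter,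
    Finset.sum_eq_single_of_mem j (Finset.mem_univ j)]
  · split_ifs with hj
    · rfl
    · by_contra hz
      exact hj (h j (Ne.symm hz))
  · intro k _ hk
    split_ifs with hkj
    · by_contra hz
      exact hk ((h k hz).symm.trans hkj)
    · rfl

lemma map_apply_eq_zero {m n : ℕ} (e : Fin (m + 1) → Fin (n + 2))
    (z : stdSimplex ℝ (Fin (m + 1))) {j : Fin (n + 2)} (h : j ∉ Set.range e) : map e z j = 0 := by
  rw [map_coe, FunOnFinite.linearMap_apply_apply]
  refine Finset.sum_eq_zero fun k hk ↦ ?_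
  exact absurd ⟨k, (Finset.mem_filter.1 hk).2⟩ h

end stdSimplex

/-- A monotone retraction of a finite linear order onto a nonempty subset. -/
lemma Fin.exists_orderHom_retraction {n : ℕ} (T : Finset (Fin n)) (hT : T.Nonempty) :
    ∃ e : Fin n →o Fin n, (∀ x, e x ∈ T) ∧ ∀ x ∈ T, e x = x := by
  -- the largest element of `T` below `x`, or the least element of `T` if there is none
  let S (x : Fin n) : Finset (Fin n) := insert (T.min' hT) (T.filter (· ≤ x))
  have hS (x : Fin n) : (S x).Nonempty := Finset.insert_nonempty _ _
  have hST (x y : Fin n) (hy : y ∈ S x) : y ∈ T := by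
    rcases Finset.mem_insert.1 hy with h | hy
    · exact h ▸ Finset.min'_mem _ _
    · exact (Finset.mem_filter.1 hy).1
  have hmono (x y : Fin n) (hxy : x ≤ y) : S x ⊆ S y :=
    Finset.insert_subset_insert _ fun k hk ↦ by
      rw [Finset.mem_filter] at hk ⊢
      exact ⟨hk.1, hk.2.trans hxy⟩
  let e : Fin n →o Fin n :=
    { toFun := fun x ↦ (S x).max' (hS x)
      monotone' := fun x y hxy ↦ Finset.max'_subset (hS x) (hmono x y hxy) }
  refine ⟨e, fun x ↦ hST x _ (Finset.max'_mem _ (hS x)), fun x hx ↦ le_antisymm ?_ ?_⟩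
  · refine Finset.max'_le _ (hS x) _ fun y hy ↦ ?_
    rcases Finset.mem_insert.1 hy with h | hy
    · exact h.le.trans (Finset.min'_le _ _ hx)
    · exact (Finset.mem_filter.1 hy).2
  · exact Finset.le_max' (S x) x (Finset.mem_insert_of_mem (Finset.mem_filter.2 ⟨hx, le_rfl⟩))

/-- A compatible family of paths on the horn, with end points prescribed over the whole simplex,
extends to the simplex. -/
lemma stdSimplex.exists_path_extension {n : ℕ} (i : Fin (n + 2)) {Y : Type*} [TopologicalSpace Y]
    (W : ∀ j : Fin (n + 2), j ≠ i → C(stdSimplex ℝ (Fin (n + 2)), C(unitInterval, Y)))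
    (g : C(stdSimplex ℝ (Fin (n + 2)), Y × Y))
    (hW : ∀ j hj k hk, ∀ z, z j = 0 → z k = 0 → W j hj z = W k hk z)
    (hg : ∀ j hj, ∀ z, z j = 0 → (W j hj z 0, W j hj z 1) = g z) :
    ∃ H : C(stdSimplex ℝ (Fin (n + 2)), C(unitInterval, Y)),
      (∀ z, (H z 0, H z 1) = g z) ∧ ∀ j hj, ∀ z, z j = 0 → H z = W j hj z := by
  classical
  let F (q : stdSimplex ℝ (Fin (n + 2)) × unitInterval) : Y :=
    if h : ∃ j ≠ i, q.1 j = 0 then W h.choose h.choose_spec.1 q.1 q.2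
    else if q.2 = 0 then (g q.1).1 else (g q.1).2
  have hF_face (j : Fin (n + 2)) (hj : j ≠ i) (q : stdSimplex ℝ (Fin (n + 2)) × unitInterval)
      (hq : q.1 j = 0) : F q = W j hj q.1 q.2 := by
    have h : ∃ j ≠ i, q.1 j = 0 := ⟨j, hj, hq⟩
    simp only [F, dif_pos h]
    rw [hW _ h.choose_spec.1 j hj _ h.choose_spec.2 hq]
  have hF_zero (x : stdSimplex ℝ (Fin (n + 2))) : F (x, 0) = (g x).1 := by
    by_cases h : ∃ j ≠ i, x j = 0
    · obtain ⟨j, hj, hx⟩ := h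
      rw [hF_face j hj (x, 0) hx, ← hg j hj x hx]
    · simp only [F, dif_neg h, if_pos]
  have hF_one (x : stdSimplex ℝ (Fin (n + 2))) : F (x, 1) = (g x).2 := by
    by_cases h : ∃ j ≠ i, x j = 0
    · obtain ⟨j, hj, hx⟩ := h
      rw [hF_face j hj (x, 1) hx, ← hg j hj x hx]
    · simp only [F, dif_neg h, if_neg one_ne_zero]
  have hF : ContinuousOn F (hornPrism i) := by
    have hset : hornPrism i = (⋃ j : {j // j ≠ i}, {q | q.1 j = 0}) ∪ ({q | q.2 = 0} ∪
        {q | q.2 = 1}) := by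
      ext q
      simp [hornPrism, hornSet]
    have hcl (j : Fin (n + 2)) :
        IsClosed ((fun q : stdSimplex ℝ (Fin (n + 2)) × unitInterval ↦ q.1 j) ⁻¹' {0}) :=
      isClosed_singleton.preimage ((continuous_apply' j).comp continuous_fst)
    rw [hset]
    refine ContinuousOn.union_of_isClosed ?_ (ContinuousOn.union_of_isClosed ?_ ?_
      (isClosed_eq continuous_snd continuous_const)
      (isClosed_eq continuous_snd continuous_const)) (isClosed_iUnion_of_finite fun j ↦ hcl j) ?_
    · refine (locallyFinite_of_finite _).continuousOn_iUnion (fun j ↦ hcl j) fun j ↦ ?_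
      refine ContinuousOn.congr (f := fun q ↦ W j j.2 q.1 q.2) ?_ fun q hq ↦ hF_face j j.2 q hq
      exact Continuous.continuousOn (by fun_prop)
    · refine ContinuousOn.congr (f := fun q ↦ (g q.1).1) ?_ ?_
      · exact Continuous.continuousOn (by fun_prop)
      · rintro ⟨x, _⟩ rfl
        exact hF_zero x
    · refine ContinuousOn.congr (f := fun q ↦ (g q.1).2) ?_ ?_
      · exact Continuous.continuousOn (by fun_prop)
      · rintro ⟨x, _⟩ rfl
        exact hF_one x
    · exact (isClosed_eq continuous_snd continuous_const).union
        (isClosed_eq continuous_snd continuous_const)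
  obtain ⟨F', hF'⟩ := exists_continuous_extension i F hF
  refine ⟨F'.curry, fun z ↦ ?_, fun j hj z hz ↦ ?_⟩
  · rw [ContinuousMap.curry_apply, ContinuousMap.curry_apply, hF' (Or.inr (Or.inl rfl)),
      hF' (Or.inr (Or.inr rfl)), hF_zero, hF_one]
  · ext t
    rw [ContinuousMap.curry_apply, hF' (Or.inl ⟨j, hj, hz⟩), hF_face j hj _ hz]

namespace TopCat

variable (Y : TopCat.{u})

/-- The evaluation of paths at both end points. -/
def endpoints : TopCat.of C(unitInterval, Y) ⟶ TopCat.of (Y × Y) :=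
  TopCat.ofHom ⟨fun γ ↦ (γ 0, γ 1), by fun_prop⟩

open SSet in
/-- A lifting problem is a family of paths over the horn with end points prescribed over the
whole simplex. The simplices of the horn are glued to a function on the geometric horn by means of
monotone retractions `e T` of the vertices onto the faces `T` that contain `i`. -/
lemma endpoints_hasLiftingProperty {n : ℕ} (i : Fin (n + 2)) :
    HasLiftingProperty (horn.{u} (n + 1) i).ι (toSSet.map (endpoints Y)) where
  sq_hasLift {f b} sq := by
    classical
    have hret (T : Finset (Fin (n + 2))) : ∃ e : Fin (n + 2) →o Fin (n + 2),
        i ∈ T → (∀ x, e x ∈ T) ∧ ∀ x ∈ T, e x = x := by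
      by_cases hT : i ∈ T
      · obtain ⟨e, he⟩ := Fin.exists_orderHom_retraction T ⟨i, hT⟩
        exact ⟨e, fun _ ↦ he⟩
      · exact ⟨OrderHom.id, fun h ↦ absurd h hT⟩
    choose e he using hret
    have hmem {m : ℕ} (α : ⦋m⦌ ⟶ ⦋n + 1⦌) (hα : ∃ j ≠ i, j ∉ Set.range α.toOrderHom) :
        stdSimplex.objEquiv.symm α ∈ (horn.{u} (n + 1) i).obj (op ⦋m⦌) := by
      obtain ⟨j, hj, h⟩ := hα
      exact (mem_horn_iff_notMem_range _ i).2 ⟨j, hj, h⟩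
    -- the value of `f` on a simplex of the horn, as a continuous map
    let val {m : ℕ} (α : ⦋m⦌ ⟶ ⦋n + 1⦌) (hα : ∃ j ≠ i, j ∉ Set.range α.toOrderHom) :
        C(stdSimplex ℝ (Fin (m + 1)), C(unitInterval, Y)) :=
      (TopCat.of C(unitInterval, Y)).toSSetObjEquiv (op ⦋m⦌) (f.app (op ⦋m⦌) ⟨_, hmem α hα⟩)
    have hval {m k : ℕ} (α : ⦋m⦌ ⟶ ⦋n + 1⦌) (β : ⦋k⦌ ⟶ ⦋m⦌) (γ : ⦋k⦌ ⟶ ⦋n + 1⦌) (h : β ≫ α = γ)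
        (hα : ∃ j ≠ i, j ∉ Set.range α.toOrderHom) (hγ : ∃ j ≠ i, j ∉ Set.range γ.toOrderHom)
        (z : stdSimplex ℝ (Fin (k + 1))) :
        val γ hγ z = val α hα (stdSimplex.map β.toOrderHom z) := by
      subst h
      have h := NatTrans.naturality_apply f β.op
        (⟨_, hmem α hα⟩ : (Λ[n + 1, i] : SSet.{u}).obj (op ⦋m⦌))
      exact congrArg (fun x ↦ (TopCat.of C(unitInterval, Y)).toSSetObjEquiv (op ⦋k⦌) x z) h
    have he_mem (T : Finset (Fin (n + 2))) (hi : i ∈ T) (hT : ∃ j, j ∉ T) :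
        ∃ j ≠ i, j ∉ Set.range (SimplexCategory.Hom.mk (e T) : ⦋n + 1⦌ ⟶ ⦋n + 1⦌).toOrderHom := by
      obtain ⟨j, hj⟩ := hT
      refine ⟨j, fun h ↦ hj (h ▸ hi), ?_⟩
      rintro ⟨x, rfl⟩
      exact hj ((he T hi).1 x)
    -- the value at a point is computed by any retraction fixing the support of the point
    have hval_eq (T T' : Finset (Fin (n + 2))) (hi : i ∈ T) (hTT' : T ⊆ T') (hT : ∃ j, j ∉ T)
        (hT' : ∃ j, j ∉ T') (z : stdSimplex ℝ (Fin (n + 2))) (hz : ∀ j, z j ≠ 0 → j ∈ T) :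
        val (SimplexCategory.Hom.mk (e T')) (he_mem T' (hTT' hi) hT') z =
          val (SimplexCategory.Hom.mk (e T)) (he_mem T hi hT) z := by
      have hz' : stdSimplex.map (e T) z = z :=
        stdSimplex.map_eq_self _ _ fun j hj ↦ (he T hi).2 j (hz j hj)
      refine Eq.trans ?_ (hval (SimplexCategory.Hom.mk (e T')) (SimplexCategory.Hom.mk (e T)) _ ?_
        (he_mem T' (hTT' hi) hT') (he_mem T hi hT) z).symm
      · exact congrArg _ hz'.symm
      · ext x : 3
        exact (he T' (hTT' hi)).2 _ (hTT' ((he T hi).1 x))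
    let g : C(stdSimplex ℝ (Fin (n + 2)), Y × Y) :=
      (TopCat.of (Y × Y)).toSSetObjEquiv (op ⦋n + 1⦌) (yonedaEquiv b)
    have hgval {m : ℕ} (α : ⦋m⦌ ⟶ ⦋n + 1⦌) (hα : ∃ j ≠ i, j ∉ Set.range α.toOrderHom)
        (z : stdSimplex ℝ (Fin (m + 1))) :
        (val α hα z 0, val α hα z 1) = g (stdSimplex.map α.toOrderHom z) := by
      have h := NatTrans.congr_app sq.w (op ⦋m⦌)
      have h' := ConcreteCategory.congr_hom h ⟨_, hmem α hα⟩
      have h'' := congrArg (fun x ↦ (TopCat.of (Y × Y)).toSSetObjEquiv (op ⦋m⦌) x z) h'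
      refine h''.trans ?_
      have hb : b.app (op ⦋m⦌) (stdSimplex.objEquiv.symm α) =
          (toSSet.obj (TopCat.of (Y × Y))).map α.op (yonedaEquiv b) := by
        obtain ⟨y, rfl⟩ := yonedaEquiv.symm.surjective b
        rw [Equiv.apply_symm_apply]
        rfl
      exact congrArg (fun x ↦ (TopCat.of (Y × Y)).toSSetObjEquiv (op ⦋m⦌) x z) hb
    have hiT {j : Fin (n + 2)} (hj : j ≠ i) : i ∈ ({j}ᶜ : Finset (Fin (n + 2))) := by
      simpa using hj.symm
    have hjT (j : Fin (n + 2)) : ∃ k, k ∉ ({j}ᶜ : Finset (Fin (n + 2))) := ⟨j, by simp⟩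
    have hWg (j : Fin (n + 2)) (hj : j ≠ i) (z : stdSimplex ℝ (Fin (n + 2))) (hz : z j = 0) :
        (val (SimplexCategory.Hom.mk (e {j}ᶜ)) (he_mem {j}ᶜ (hiT hj) (hjT j)) z 0,
          val (SimplexCategory.Hom.mk (e {j}ᶜ)) (he_mem {j}ᶜ (hiT hj) (hjT j)) z 1) = g z := by
      refine (hgval (SimplexCategory.Hom.mk (e {j}ᶜ)) (he_mem {j}ᶜ (hiT hj) (hjT j)) z).trans
        (congrArg g (stdSimplex.map_eq_self _ _ fun l hl ↦ (he _ (hiT hj)).2 l ?_))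
      rw [Finset.mem_compl, Finset.mem_singleton]
      rintro rfl
      exact hl hz
    obtain ⟨H, hH, hH'⟩ := stdSimplex.exists_path_extension i
      (fun j hj ↦ val (SimplexCategory.Hom.mk (e {j}ᶜ)) (he_mem {j}ᶜ (hiT hj) (hjT j))) g
      (fun j hj k hk z hzj hzk ↦ by
        have hT : ∃ l, l ∉ insert i (Finset.univ.filter fun l ↦ z l ≠ 0) :=
          ⟨j, by simp [hj, hzj]⟩
        have hz (l : Fin (n + 2)) (hl : z l ≠ 0) :
            l ∈ insert i (Finset.univ.filter fun l ↦ z l ≠ 0) := by simp [hl]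
        have hsub (l : Fin (n + 2)) (hl : l ≠ i) (hzl : z l = 0) :
            insert i (Finset.univ.filter fun l ↦ z l ≠ 0) ⊆ ({l}ᶜ : Finset (Fin (n + 2))) := by
          intro x hx
          rw [Finset.mem_compl, Finset.mem_singleton]
          rintro rfl
          simp [hl, hzl] at hx
        rw [hval_eq _ _ (Finset.mem_insert_self _ _) (hsub j hj hzj) hT (hjT j) z hz,
          hval_eq _ _ (Finset.mem_insert_self _ _) (hsub k hk hzk) hT (hjT k) z hz])
      hWg
    refine ⟨⟨⟨yonedaEquiv.symm
      (((TopCat.of C(unitInterval, Y)).toSSetObjEquiv (op ⦋n + 1⦌)).symm H), ?_, ?_⟩⟩⟩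
    · apply SSet.hom_ext
      intro m
      induction m using Opposite.rec with | _ m
      induction m using SimplexCategory.rec with | _ m
      apply ConcreteCategory.hom_ext
      rintro ⟨y, hy⟩
      obtain ⟨α, rfl⟩ := stdSimplex.objEquiv.symm.surjective y
      obtain ⟨j, hj, hα⟩ := (mem_horn_iff_notMem_range _ i).1 hy
      apply ((TopCat.of C(unitInterval, Y)).toSSetObjEquiv (op ⦋m⦌)).injective
      ext1 z
      have h₁ := hH' j hj (stdSimplex.map α.toOrderHom z) (stdSimplex.map_apply_eq_zero _ _ hα)
      have h₂ := hval (SimplexCategory.Hom.mk (e {j}ᶜ)) α α (by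
        ext x : 3
        refine (he _ (hiT hj)).2 _ ?_
        rw [Finset.mem_compl, Finset.mem_singleton]
        exact fun h ↦ hα ⟨x, h⟩) (he_mem {j}ᶜ (hiT hj) (hjT j)) ⟨j, hj, hα⟩ z
      exact h₁.trans h₂.symm
    · apply SSet.yonedaEquiv.injective
      rw [yonedaEquiv_comp, Equiv.apply_symm_apply]
      apply ((TopCat.of (Y × Y)).toSSetObjEquiv (op ⦋n + 1⦌)).injective
      ext1 z
      exact hH z

/-- The path fibration of a space is a Kan fibration after passing to singular simplicial sets. -/
lemma endpoints_mem_fibrations :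
    SSet.modelCategoryQuillen.J.{u}.rlp (toSSet.map (endpoints Y)) := by
  intro _ _ f hf
  simp only [SSet.modelCategoryQuillen.J, MorphismProperty.iSup_iff] at hf
  obtain ⟨n, ⟨i⟩⟩ := hf
  exact endpoints_hasLiftingProperty _ i

end TopCat

/-! ### Anodyne vertices and contractibility -/

namespace SSet

/-- The subcomplex generated by a vertex is a point. -/
lemma subsingleton_realization_ofSimplex {X : SSet.{u}} (v : X _⦋0⦌) :
    Subsingleton (SSet.toTop.obj ((Subcomplex.ofSimplex v : X.Subcomplex) : SSet.{u})) := by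
  have hepi : Epi (Subcomplex.toOfSimplex v) := inferInstance
  have : Epi (SSet.toTop.map (Subcomplex.toOfSimplex v)) := inferInstance
  have := (TopCat.epi_iff_surjective _).1 this
  exact this.subsingleton

/-- If a vertex inclusion is anodyne, then it has the left lifting property against the path
fibration `γ ↦ (γ 0, γ 1)` after realization. Lifting `x ↦ (x, x₀)` gives a contraction. -/
theorem contractibleSpace_of_anodyne {X : SSet.{u}} (v : X _⦋0⦌)
    (h : anodyneExtensions (Subcomplex.ofSimplex v).ι) :
    ContractibleSpace (SSet.toTop.obj X) := by
  have hlift : HasLiftingProperty (Subcomplex.ofSimplex v).ι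
      (TopCat.toSSet.map (TopCat.endpoints (SSet.toTop.obj X))) :=
    h _ (TopCat.endpoints_mem_fibrations _)
  rw [← sSetTopAdj.hasLiftingProperty_iff] at hlift
  have hsub := subsingleton_realization_ofSimplex v
  let a₀ : SSet.toTop.obj ((Subcomplex.ofSimplex v : X.Subcomplex) : SSet.{u}) :=
    SSet.toTop.map (Subcomplex.toOfSimplex v) default
  let x₀ : SSet.toTop.obj X := SSet.toTop.map (Subcomplex.ofSimplex v).ι a₀
  have sq : CommSq
      (TopCat.ofHom (.const _ (.const _ x₀)) :
        SSet.toTop.obj ((Subcomplex.ofSimplex v : X.Subcomplex) : SSet.{u}) ⟶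
          TopCat.of C(unitInterval, SSet.toTop.obj X))
      (SSet.toTop.map (Subcomplex.ofSimplex v).ι)
      (TopCat.endpoints (SSet.toTop.obj X))
      (TopCat.ofHom ((ContinuousMap.id _).prodMk (.const _ x₀))) := by
    constructor
    ext a
    · rw [Subsingleton.elim a a₀]
      rfl
    · rfl
  obtain ⟨l, -, hl⟩ := (hlift.sq_hasLift sq).exists_lift
  rw [contractible_iff_id_nullhomotopic]
  have hl' (x : SSet.toTop.obj X) : (l x 0, l x 1) = (x, x₀) := ConcreteCategory.congr_hom hl x
  exact ⟨x₀, ⟨{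
    toContinuousMap := ⟨fun q ↦ l q.2 q.1, by fun_prop⟩
    map_zero_left := fun x ↦ congrArg Prod.fst (hl' x)
    map_one_left := fun x ↦ congrArg Prod.snd (hl' x) }⟩⟩

end SSet

/-! ### Morse matchings with one critical vertex -/

namespace SSet

variable {X : SSet.{u}}

lemma eq_of_mem_ofSimplex_of_nonDegenerate {v : X _⦋0⦌} {n : ℕ} {x : X _⦋n⦌}
    (hx : x ∈ X.nonDegenerate n) (h : x ∈ (Subcomplex.ofSimplex v).obj (op ⦋n⦌)) :
    (⟨n, x⟩ : (n : ℕ) × X _⦋n⦌) = ⟨0, v⟩ := by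
  obtain ⟨f, rfl⟩ := (Subcomplex.mem_ofSimplex_obj_iff _ _).1 h
  have := _root_.SSet.mono_of_nonDegenerate (X := X) ⟨_, hx⟩ f v rfl
  obtain rfl : n = 0 := Nat.le_zero.1 (SimplexCategory.le_of_mono f)
  obtain rfl : f = 𝟙 _ := Subsingleton.elim _ _
  simp

namespace MatchingData

variable (M : MatchingData X)

lemma redundant_subset (n : ℕ) : M.redundant n ⊆ X.nonDegenerate n := fun _ hx ↦
  M.union_eq n ▸ Or.inl (Or.inr hx)

lemma collapsible_subset (n : ℕ) : M.collapsible n ⊆ X.nonDegenerate n := fun _ hx ↦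
  M.union_eq n ▸ Or.inr hx

end MatchingData

namespace MorseMatching

variable (M : MorseMatching X) {v : X _⦋0⦌}

lemma wellFounded_edge : WellFounded (fun a b ↦ M.Edge b a) := by
  rw [wellFounded_iff_isEmpty_descending_chain]
  exact ⟨fun ⟨f, hf⟩ ↦ M.no_infinite_path ⟨f, hf⟩⟩

/-- By acyclicity, a redundant cell is a face of its partner in only one way. -/
lemma eq_ι {n : ℕ} (τ : M.redundant n) {j : Fin (n + 2)}
    (hj : X.δ j (M.c n τ : X _⦋n + 1⦌) = τ) : j = M.ι n τ := by
  by_contra hne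
  have h₁ : M.Edge ⟨n, τ⟩ ⟨n + 1, M.c n τ⟩ := .up τ
  have h₂ := MatchingData.Edge.down (M := M.toMatchingData) (M.c n τ) j (by simpa using hne)
    (by rw [hj]; exact Or.inl τ.2)
  rw [hj] at h₂
  have h := M.wellFounded_edge.transGen
  exact h.irrefl.irrefl _ (Relation.TransGen.tail (.single h₂) h₁)

variable (h₀ : M.critical 0 = {v}) (h₁ : ∀ n, 0 < n → M.critical n = ∅)

include h₀ in
lemma notMem_ofSimplex {n : ℕ} {x : X _⦋n⦌} (hx : x ∈ X.nonDegenerate n)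
    (hx' : x ∉ M.critical n) : x ∉ (Subcomplex.ofSimplex v).obj (op ⦋n⦌) := by
  intro h
  cases eq_of_mem_ofSimplex_of_nonDegenerate hx h
  exact hx' (h₀ ▸ rfl)

/-- The pairing, in the sense of Moss, defined by a Morse matching with one critical vertex. -/
def pairingCore : (Subcomplex.ofSimplex v).PairingCore where
  ι := (n : ℕ) × M.redundant n
  dim s := s.1
  simplex s := M.c s.1 s.2
  index s := M.ι s.1 s.2
  nonDegenerate₁ s := M.collapsible_subset _ (M.c s.1 s.2).2
  nonDegenerate₂ s := by
    rw [M.δ_ι]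
    exact M.redundant_subset _ s.2.2
  notMem₁ s := M.notMem_ofSimplex h₀ (M.collapsible_subset _ (M.c s.1 s.2).2)
    (by simp [h₁])
  notMem₂ s := by
    rw [M.δ_ι]
    exact M.notMem_ofSimplex h₀ (M.redundant_subset _ s.2.2)
      ((M.disjoint_critical_redundant _).notMem_of_mem_right s.2.2)
  injective_type₁' {s t} h := by
    obtain ⟨n, s⟩ := s
    obtain ⟨m, t⟩ := t
    obtain rfl : n = m := by simpa using S.dim_eq_of_mk_eq h
    have h' : M.c n s = M.c n t := by
      ext
      simpa using h
    rw [(M.c n).injective h']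
  injective_type₂' {s t} h := by
    obtain ⟨n, s⟩ := s
    obtain ⟨m, t⟩ := t
    obtain rfl : n = m := by simpa using S.dim_eq_of_mk_eq h
    rw [M.δ_ι, M.δ_ι] at h
    have h' : s = t := by
      ext
      simpa using h
    rw [h']
  type₁_ne_type₂' s t h := by
    obtain ⟨n, s⟩ := s
    obtain ⟨m, t⟩ := t
    obtain rfl : n + 1 = m := by simpa using S.dim_eq_of_mk_eq h
    rw [M.δ_ι] at h
    have h' : (M.c n s : X _⦋n + 1⦌) = t := by simpa using h
    exact (M.disjoint_redundant_collapsible _).notMem_of_mem_left t.2 (h' ▸ (M.c n s).2)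
  surjective' x := by
    obtain ⟨n, x, hx, hx', rfl⟩ := x.mk_surjective
    have hx'' := hx
    rw [← M.union_eq n] at hx''
    rcases hx'' with (h | h) | h
    · exfalso
      rcases n with _ | n
      · rw [h₀] at h
        cases h
        exact hx' (Subcomplex.mem_ofSimplex_obj _)
      · simp [h₁] at h
    · exact ⟨⟨n, x, h⟩, Or.inr (by rw [M.δ_ι]; rfl)⟩
    · rcases n with _ | n
      · simp [M.collapsible_zero] at h
      · exact ⟨⟨n, (M.c n).symm ⟨x, h⟩⟩, Or.inl (by simp; rfl)⟩

instance : (M.pairingCore h₀ h₁).IsProper where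
  isUniquelyCodimOneFace s :=
    (S.IsUniquelyCodimOneFace.iff _ _).2 ⟨M.ι s.1 s.2, rfl, fun _ hj ↦
      M.eq_ι s.2 (hj.trans (M.δ_ι s.1 s.2))⟩

/-- The rank of a redundant cell in the well-founded relation generated by the edges of the
matching. -/
noncomputable def rankFunction : (M.pairingCore h₀ h₁).WeakRankFunction Ordinal.{u} where
  rank s :=
    haveI : IsWellFounded _ (Relation.TransGen fun a b ↦ M.Edge b a) :=
      ⟨M.wellFounded_edge.transGen⟩
    IsWellFounded.rank (Relation.TransGen fun a b ↦ M.Edge b a)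
      (⟨s.1, s.2⟩ : (n : ℕ) × X _⦋n⦌)
  lt {s t} hst hdim := by
    have : IsWellFounded _ (Relation.TransGen fun a b ↦ M.Edge b a) :=
      ⟨M.wellFounded_edge.transGen⟩
    apply IsWellFounded.rank_lt_of_rel
    obtain ⟨n, s⟩ := s
    obtain ⟨m, t⟩ := t
    obtain rfl : n = m := hdim
    obtain ⟨hne, hlt⟩ := hst
    obtain ⟨f, hfm, hf⟩ : ∃ (f : ⦋n⦌ ⟶ ⦋n + 1⦌) (_ : Mono f),
        X.map f.op (M.c n t : X _⦋n + 1⦌) = X.δ (M.ι n s) (M.c n s : X _⦋n + 1⦌) :=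
      N.le_iff_exists_mono.1 hlt.le
    obtain ⟨j, rfl⟩ := SimplexCategory.eq_δ_of_mono f
    replace hf : X.δ j (M.c n t : X _⦋n + 1⦌) = s := hf.trans (M.δ_ι n s)
    have h₂ := MatchingData.Edge.down (M := M.toMatchingData) (M.c n t) j (by
      rintro rfl
      apply hne
      rw [Equiv.symm_apply_apply, M.δ_ι] at hf
      rw [Subtype.ext hf]) (by rw [hf]; exact Or.inl s.2)
    rw [hf] at h₂
    exact .tail (.single h₂) (.up t)

include h₀ h₁ in
/-- A simplicial set with a Morse matching whose only critical cell is a vertex has a contractible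
realization: it is built from the vertex by attaching, in the order of the rank, each redundant
cell together with its partner along a horn. -/
theorem contractibleSpace : ContractibleSpace (SSet.toTop.obj X) := by
  have := (M.rankFunction h₀ h₁).isRegular
  exact contractibleSpace_of_anodyne v (M.pairingCore h₀ h₁).pairing.anodyneExtensions

end MorseMatching

end SSet

/-! ### Sylow subgroups of subgroups -/

section Groups

variable {G : Type u} [Group G] {p : ℕ}

lemma mem_normalizer_iff_conj_smul {H : Subgroup G} {g : G} :
    g ∈ Subgroup.normalizer (H : Set G) ↔ MulAut.conj g • H = H :=
  Subgroup.mem_normalizer_iff_map_conj_eq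

/-- A finite `p`-subgroup, the objects from which all chains are built. -/
structure IsFinitePSubgroup (p : ℕ) (P : Subgroup G) : Prop where
  finite : Finite P
  isPGroup : IsPGroup p P

/-- `R` is a Sylow `p`-subgroup of the subgroup `K`, phrased inside the ambient group. -/
structure IsSylowIn (p : ℕ) (K R : Subgroup G) : Prop extends IsFinitePSubgroup p R where
  le : R ≤ K
  conj_le : ∀ P : Subgroup G, IsFinitePSubgroup p P → P ≤ K → ∃ g ∈ K, MulAut.conj g • P ≤ R

lemma IsFinitePSubgroup.mono {P Q : Subgroup G} (hQ : IsFinitePSubgroup p Q) (h : P ≤ Q) :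
    IsFinitePSubgroup p P :=
  have := hQ.finite
  ⟨Finite.of_injective _ (Subgroup.inclusion_injective h), hQ.isPGroup.to_le h⟩

lemma IsFinitePSubgroup.of_mulEquiv {H : Type u} [Group H] {P : Subgroup G} {Q : Subgroup H}
    (hP : IsFinitePSubgroup p P) (e : P ≃* Q) : IsFinitePSubgroup p Q :=
  have := hP.finite
  ⟨Finite.of_equiv _ e.toEquiv, hP.isPGroup.of_equiv e⟩

lemma IsFinitePSubgroup.smul {P : Subgroup G} (hP : IsFinitePSubgroup p P) (a : MulAut G) :
    IsFinitePSubgroup p (a • P) :=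
  hP.of_mulEquiv (Subgroup.equivSMul a P)

lemma IsFinitePSubgroup.sup {P Q : Subgroup G} (hP : IsFinitePSubgroup p P)
    (hQ : IsFinitePSubgroup p Q) (h : P ≤ Subgroup.normalizer (Q : Set G)) :
    IsFinitePSubgroup p (P ⊔ Q) := by
  refine ⟨?_, hP.isPGroup.to_sup_of_normal_right' hQ.isPGroup h⟩
  have := hP.finite
  have := hQ.finite
  rw [← SetLike.coe_sort_coe, Subgroup.coe_mul_of_left_le_normalizer_right P Q h]
  exact Set.Finite.mul (Set.toFinite (P : Set G)) (Set.toFinite (Q : Set G))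

lemma card_smul (a : MulAut G) (P : Subgroup G) : Nat.card (a • P : Subgroup G) = Nat.card P :=
  Nat.card_congr (Subgroup.equivSMul a P).symm.toEquiv

lemma IsFinitePSubgroup.eq_of_le_of_smul_le {P Q : Subgroup G} (hP : IsFinitePSubgroup p P)
    (hQ : IsFinitePSubgroup p Q) (h : P ≤ Q) {a : MulAut G} (ha : a • Q ≤ P) : P = Q := by
  have := hQ.finite
  have := hP.finite
  exact Subgroup.eq_of_le_of_card_ge h (card_smul a Q ▸ Subgroup.card_le_of_le ha)

/-- Normalizers grow in finite `p`-groups. -/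
lemma IsFinitePSubgroup.lt_normalizer_inf [Fact p.Prime] {P Q : Subgroup G}
    (hQ : IsFinitePSubgroup p Q) (h : P < Q) :
    P < Subgroup.normalizer (P : Set G) ⊓ Q := by
  have := hQ.finite
  have := hQ.isPGroup.isNilpotent
  refine lt_of_le_of_ne (le_inf Subgroup.le_normalizer h.le) fun heq ↦ ?_
  have hlt : P.subgroupOf Q < ⊤ := by
    rw [lt_top_iff_ne_top, Ne, Subgroup.subgroupOf_eq_top]
    exact not_le_of_gt h
  obtain ⟨-, x, hx, hx'⟩ := SetLike.lt_iff_le_and_exists.1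
    (Group.normalizerCondition_of_isNilpotent _ hlt)
  apply hx'
  rw [Subgroup.mem_subgroupOf, heq]
  refine ⟨?_, x.2⟩
  change (x : G) ∈ Subgroup.normalizer (P : Set G)
  rw [Subgroup.mem_normalizer_iff] at hx ⊢
  intro y
  by_cases hy : y ∈ Q
  · simpa [Subgroup.mem_subgroupOf] using hx ⟨y, hy⟩
  · have hy' : (x : G) * y * (x : G)⁻¹ ∉ Q := fun hmem ↦ hy (by
      simpa [mul_assoc] using Q.mul_mem (Q.mul_mem (Q.inv_mem x.2) hmem) x.2)
    exact iff_of_false (fun h' ↦ hy (h.le h')) (fun h' ↦ hy' (h.le h'))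

namespace IsSylowIn

variable {K R : Subgroup G}

lemma le_of_le_normalizer (hR : IsSylowIn p K R) {P : Subgroup G} (hP : IsFinitePSubgroup p P)
    (hPK : P ≤ K) (h : P ≤ Subgroup.normalizer (R : Set G)) : P ≤ R := by
  have hsup := hP.sup hR.toIsFinitePSubgroup h
  obtain ⟨g, -, hg⟩ := hR.conj_le _ hsup (sup_le hPK hR.le)
  rw [hR.toIsFinitePSubgroup.eq_of_le_of_smul_le hsup le_sup_right hg]
  exact le_sup_left

lemma exists_conj_eq (hR : IsSylowIn p K R) {R' : Subgroup G} (hR' : IsSylowIn p K R') :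
    ∃ g ∈ K, MulAut.conj g • R = R' := by
  obtain ⟨g, hg, h⟩ := hR'.conj_le R hR.toIsFinitePSubgroup hR.le
  obtain ⟨g', -, h'⟩ := hR.conj_le R' hR'.toIsFinitePSubgroup hR'.le
  refine ⟨g, hg, (hR.smul _).eq_of_le_of_smul_le hR'.toIsFinitePSubgroup h
    (a := MulAut.conj g * MulAut.conj g') ?_⟩
  rw [mul_smul, Subgroup.pointwise_smul_le_pointwise_smul_iff]
  exact h'

lemma conj_smul_le {g : G} (hg : g ∈ K) {P : Subgroup G} (hP : P ≤ K) :
    MulAut.conj g • P ≤ K :=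
  Subgroup.conj_smul_le_of_le hP ⟨g, hg⟩

lemma conj_smul (hR : IsSylowIn p K R) {g : G} (hg : g ∈ K) :
    IsSylowIn p K (MulAut.conj g • R) where
  toIsFinitePSubgroup := hR.smul _
  le := conj_smul_le hg hR.le
  conj_le P hP hPK := by
    obtain ⟨x, hx, h⟩ := hR.conj_le P hP hPK
    refine ⟨g * x, K.mul_mem hg hx, ?_⟩
    rw [map_mul, mul_smul, Subgroup.pointwise_smul_le_pointwise_smul_iff]
    exact h

/-- A maximal finite `p`-subgroup of a group with a Sylow `p`-subgroup is itself one. -/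
lemma of_maximal (hR : IsSylowIn p K R) {P : Subgroup G} (hP : IsFinitePSubgroup p P)
    (hPK : P ≤ K) (hmax : ∀ Q, IsFinitePSubgroup p Q → P ≤ Q → Q ≤ K → Q = P) :
    IsSylowIn p K P := by
  obtain ⟨g, hg, h⟩ := hR.conj_le P hP hPK
  have h' := hR.conj_smul (K.inv_mem hg)
  rw [hmax _ h'.toIsFinitePSubgroup ?_ h'.le] at h'
  · exact h'
  · rwa [map_inv, Subgroup.subset_pointwise_smul_iff, inv_inv]

lemma of_isFinitePSubgroup (hK : IsFinitePSubgroup p K) : IsSylowIn p K K where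
  toIsFinitePSubgroup := hK
  le := le_rfl
  conj_le P _ hPK := ⟨1, K.one_mem, by simpa using hPK⟩

lemma of_isSylowSubgroup {S : Subgroup K} (hS : IsSylowSubgroup p S) :
    IsSylowIn p K (S.map K.subtype) where
  toIsFinitePSubgroup := (IsFinitePSubgroup.mk hS.finite hS.isPGroup).of_mulEquiv
    (S.equivMapOfInjective _ K.subtype_injective)
  le := Subgroup.map_subtype_le S
  conj_le P hP hPK := by
    have := hP.finite
    have e := Subgroup.subgroupOfEquivOfLe hPK
    obtain ⟨g, hg⟩ := hS.conj_le (P.subgroupOf K) (Finite.of_equiv _ e.symm.toEquiv)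
      (hP.isPGroup.of_equiv e.symm)
    refine ⟨g, g.2, ?_⟩
    rintro _ ⟨x, hx, rfl⟩
    have h := hg (Subgroup.smul_mem_pointwise_smul (⟨x, hPK hx⟩ : K) (MulAut.conj g)
      (P.subgroupOf K) hx)
    exact ⟨_, h, rfl⟩

lemma _root_.IsSylowSubgroup.isSylowIn_top {S : Subgroup G} (hS : IsSylowSubgroup p S) :
    IsSylowIn p ⊤ S where
  finite := hS.finite
  isPGroup := hS.isPGroup
  le := le_top
  conj_le P hP _ := by
    obtain ⟨g, hg⟩ := hS.conj_le P hP.finite hP.isPGroup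
    exact ⟨g, trivial, hg⟩

lemma isSylowSubgroup {S : Subgroup G} (hS : IsSylowIn p ⊤ S) : IsSylowSubgroup p S where
  finite := hS.finite
  isPGroup := hS.isPGroup
  conj_le P hP hP' := by
    obtain ⟨g, -, hg⟩ := hS.conj_le P ⟨hP, hP'⟩ le_top
    exact ⟨g, hg⟩

end IsSylowIn

/-- Sylow's theorems provide Sylow subgroups, in the sense used here, of a finite group. -/
lemma exists_isSylowSubgroup_of_finite [Fact p.Prime] [Finite G] :
    ∃ S : Subgroup G, IsSylowSubgroup p S := by
  obtain ⟨S⟩ := (inferInstance : Nonempty (Sylow p G))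
  refine ⟨S, inferInstance, S.isPGroup', fun P _ hP ↦ ?_⟩
  obtain ⟨Q, hQ⟩ := hP.exists_le_sylow
  obtain ⟨g, hg⟩ := MulAction.exists_smul_eq G Q S
  refine ⟨g, ?_⟩
  rw [← hg, Sylow.coe_subgroup_smul]
  exact Subgroup.pointwise_smul_le_pointwise_smul_iff.2 hQ

lemma isPseudoFinite_of_finite [Fact p.Prime] [Finite G] : IsPseudoFinite p G :=
  fun _ _ _ _ ↦ exists_isSylowSubgroup_of_finite

end Groups

/-! ### Chains of `p`-subgroups and their normal parts -/

section Chains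

/-- A nonempty finite set of pairwise comparable elements has a largest element. -/
lemma Finset.exists_le_of_comparable {α : Type*} [PartialOrder α] {s : Finset α}
    (hs : s.Nonempty) (h : ∀ x ∈ s, ∀ y ∈ s, x ≤ y ∨ y ≤ x) : ∃ m ∈ s, ∀ x ∈ s, x ≤ m := by
  obtain ⟨m, hm⟩ := s.exists_maximal hs
  exact ⟨m, hm.1, fun x hx ↦ (h x hx m hm.1).elim id fun h' ↦ hm.2 hx h'⟩

/-- A nonempty finite set of pairwise comparable elements has a least element. -/
lemma Finset.exists_ge_of_comparable {α : Type*} [PartialOrder α] {s : Finset α}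
    (hs : s.Nonempty) (h : ∀ x ∈ s, ∀ y ∈ s, x ≤ y ∨ y ≤ x) : ∃ m ∈ s, ∀ x ∈ s, m ≤ x := by
  obtain ⟨m, hm⟩ := s.exists_minimal hs
  exact ⟨m, hm.1, fun x hx ↦ (h x hx m hm.1).elim (fun h' ↦ hm.2 hx h') id⟩

/-- A finite set of pairwise comparable elements can be listed in increasing order. -/
lemma Finset.exists_strictMono_of_comparable {α : Type*} [PartialOrder α] {s : Finset α} {n : ℕ}
    (hn : s.card = n) (h : ∀ x ∈ s, ∀ y ∈ s, x ≤ y ∨ y ≤ x) :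
    ∃ a : Fin n → α, StrictMono a ∧ Set.range a = s := by
  classical
  let _ : LinearOrder s :=
    { (inferInstance : PartialOrder s) with
      le_total := fun x y ↦ h x x.2 y y.2
      toDecidableLE := Classical.decRel _ }
  let e := Fintype.orderIsoFinOfCardEq s (by simpa using hn)
  refine ⟨fun i ↦ (e i : α), fun i j hij ↦ e.strictMono hij, ?_⟩
  ext x
  constructor
  · rintro ⟨i, rfl⟩
    exact (e i).2
  · intro hx
    exact ⟨e.symm ⟨x, hx⟩, by simp⟩

open scoped Classical

noncomputable section

variable {G : Type u} [Group G] {p : ℕ}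

/-- A nonempty finite chain of finite `p`-subgroups. -/
structure IsPChain (p : ℕ) (s : Finset (Subgroup G)) : Prop where
  nonempty : s.Nonempty
  comparable : ∀ P ∈ s, ∀ Q ∈ s, P ≤ Q ∨ Q ≤ P
  isFinitePSubgroup : ∀ P ∈ s, IsFinitePSubgroup p P

/-- The longest initial segment of a chain all of whose members are normal in its last member. -/
def normalPart (s : Finset (Subgroup G)) : Finset (Subgroup G) :=
  s.filter fun P ↦ ∀ Q ∈ s, Q ≤ P → P ≤ Subgroup.normalizer (Q : Set G)

/-- The last member of the normal part of a chain. -/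
def normalTop (s : Finset (Subgroup G)) : Subgroup G := (normalPart s).sup id

/-- The intersection of the normalizers of the members of the normal part with all the other
members; if the whole chain is normal, this is the normalizer of the chain, and otherwise it is
the normalizer of the normal part in the first of the other members. -/
def chainStabilizer (s : Finset (Subgroup G)) : Subgroup G :=
  (⨅ Q ∈ normalPart s, Subgroup.normalizer (Q : Set G)) ⊓ ⨅ Q ∈ s \ normalPart s, Q

/-- A chain is full if the last member of its normal part is the largest finite `p`-subgroup of
its stabilizer. -/
def IsFull (p : ℕ) (s : Finset (Subgroup G)) : Prop :=
  ∀ P, IsFinitePSubgroup p P → P ≤ chainStabilizer s → P ≤ normalTop s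

variable {s : Finset (Subgroup G)}

lemma mem_normalPart {P : Subgroup G} : P ∈ normalPart s ↔
    P ∈ s ∧ ∀ Q ∈ s, Q ≤ P → P ≤ Subgroup.normalizer (Q : Set G) :=
  Finset.mem_filter

lemma normalPart_subset : normalPart s ⊆ s := Finset.filter_subset _ _

lemma normalPart_of_le {P Q : Subgroup G} (hP : P ∈ normalPart s) (hQ : Q ∈ s) (h : Q ≤ P) :
    Q ∈ normalPart s :=
  mem_normalPart.2 ⟨hQ, fun Q' hQ' h' ↦ h.trans ((mem_normalPart.1 hP).2 Q' hQ' (h'.trans h))⟩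

lemma le_chainStabilizer_iff {H : Subgroup G} : H ≤ chainStabilizer s ↔
    (∀ Q ∈ normalPart s, H ≤ Subgroup.normalizer (Q : Set G)) ∧
      ∀ Q ∈ s, Q ∉ normalPart s → H ≤ Q := by
  simp only [chainStabilizer, le_inf_iff, le_iInf_iff, Finset.mem_sdiff, and_imp]

lemma le_normalTop {P : Subgroup G} (hP : P ∈ normalPart s) : P ≤ normalTop s :=
  Finset.le_sup (f := id) hP

lemma normalTop_eq {P : Subgroup G} (hP : P ∈ normalPart s) (h : ∀ Q ∈ normalPart s, Q ≤ P) :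
    normalTop s = P :=
  le_antisymm (Finset.sup_le h) (le_normalTop hP)

namespace IsPChain

variable (hs : IsPChain p s)

include hs

lemma exists_le_normalPart : ∃ P ∈ normalPart s, ∀ Q ∈ s, P ≤ Q := by
  obtain ⟨P, hP, h⟩ := s.exists_ge_of_comparable hs.nonempty hs.comparable
  refine ⟨P, mem_normalPart.2 ⟨hP, fun Q hQ hQP ↦ ?_⟩, h⟩
  rw [le_antisymm hQP (h Q hQ)]
  exact Subgroup.le_normalizer

lemma normalTop_mem : normalTop s ∈ normalPart s := by
  obtain ⟨P, hP, -⟩ := hs.exists_le_normalPart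
  obtain ⟨m, hm, h⟩ := (normalPart s).exists_le_of_comparable ⟨P, hP⟩
    fun x hx y hy ↦ hs.comparable x (normalPart_subset hx) y (normalPart_subset hy)
  rwa [normalTop_eq hm h]

lemma normalTop_mem' : normalTop s ∈ s := normalPart_subset hs.normalTop_mem

lemma normalTop_isFinitePSubgroup : IsFinitePSubgroup p (normalTop s) :=
  hs.isFinitePSubgroup _ hs.normalTop_mem'

lemma mem_normalPart_iff {P : Subgroup G} (hP : P ∈ s) : P ∈ normalPart s ↔ P ≤ normalTop s :=
  ⟨le_normalTop, normalPart_of_le hs.normalTop_mem hP⟩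

lemma normalTop_lt {P : Subgroup G} (hP : P ∈ s) (hP' : P ∉ normalPart s) : normalTop s < P := by
  rw [hs.mem_normalPart_iff hP] at hP'
  exact lt_of_le_not_ge ((hs.comparable _ hP _ hs.normalTop_mem').resolve_left hP') hP'

lemma normalTop_le_chainStabilizer : normalTop s ≤ chainStabilizer s :=
  le_chainStabilizer_iff.2 ⟨fun Q hQ ↦ (mem_normalPart.1 hs.normalTop_mem).2 Q
    (normalPart_subset hQ) (le_normalTop hQ), fun _ hQ hQ' ↦ (hs.normalTop_lt hQ hQ').le⟩

omit hs in
lemma _root_.chainStabilizer_le_normalizer {P : Subgroup G} (hP : P ∈ s) :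
    chainStabilizer s ≤ Subgroup.normalizer (P : Set G) := by
  by_cases h : P ∈ normalPart s
  · exact (le_chainStabilizer_iff.1 le_rfl).1 P h
  · exact ((le_chainStabilizer_iff.1 le_rfl).2 P hP h).trans Subgroup.le_normalizer

omit hs in
lemma _root_.conj_smul_eq_of_mem_chainStabilizer {g : G} (hg : g ∈ chainStabilizer s)
    {P : Subgroup G} (hP : P ∈ s) : MulAut.conj g • P = P :=
  mem_normalizer_iff_conj_smul.1 (chainStabilizer_le_normalizer hP hg)

/-- A Sylow subgroup of the stabilizer has a conjugate containing `normalTop s`, and conjugation by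
elements of the stabilizer fixes `normalTop s`. -/
lemma normalTop_le_of_isSylowIn {R : Subgroup G} (hR : IsSylowIn p (chainStabilizer s) R) :
    normalTop s ≤ R := by
  obtain ⟨g, hg, h⟩ := hR.conj_le _ hs.normalTop_isFinitePSubgroup hs.normalTop_le_chainStabilizer
  rwa [conj_smul_eq_of_mem_chainStabilizer hg hs.normalTop_mem'] at h

lemma isFull_iff {R : Subgroup G} (hR : IsSylowIn p (chainStabilizer s) R) :
    IsFull p s ↔ normalTop s = R := by
  constructor
  · intro h
    exact le_antisymm (hs.normalTop_le_of_isSylowIn hR) (h R hR.toIsFinitePSubgroup hR.le)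
  · rintro rfl P hP hPs
    obtain ⟨g, hg, h⟩ := hR.conj_le P hP hPs
    rwa [← conj_smul_eq_of_mem_chainStabilizer hg hs.normalTop_mem',
      Subgroup.pointwise_smul_le_pointwise_smul_iff] at h

lemma normalTop_lt_of_not_isFull {R : Subgroup G} (hR : IsSylowIn p (chainStabilizer s) R)
    (h : ¬ IsFull p s) : normalTop s < R :=
  lt_of_le_of_ne (hs.normalTop_le_of_isSylowIn hR) fun h' ↦ h ((hs.isFull_iff hR).2 h')

/-- In a group that is pseudo finite at `p`, chain stabilizers have Sylow subgroups: either the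
chain is normal, or the stabilizer is a finite `p`-group. -/
lemma exists_isSylowIn (hG : IsPseudoFinite p G) :
    ∃ R, IsSylowIn p (chainStabilizer s) R := by
  by_cases h : ∃ Q ∈ s, Q ∉ normalPart s
  · obtain ⟨Q, hQ, hQ'⟩ := h
    exact ⟨_, .of_isFinitePSubgroup ((hs.isFinitePSubgroup Q hQ).mono
      ((le_chainStabilizer_iff.1 le_rfl).2 Q hQ hQ'))⟩
  · push Not at h
    obtain ⟨n, hn⟩ := Nat.exists_eq_succ_of_ne_zero (Finset.card_ne_zero.2 hs.nonempty)
    obtain ⟨a, ha, hrange⟩ := Finset.exists_strictMono_of_comparable hn hs.comparable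
    have hmem (i : Fin (n + 1)) : a i ∈ s := by
      rw [← Finset.mem_coe, ← hrange]
      exact ⟨i, rfl⟩
    obtain ⟨S, hS⟩ := hG n a ha.monotone fun i ↦
      ⟨(hs.isFinitePSubgroup _ (hmem i)).finite, (hs.isFinitePSubgroup _ (hmem i)).isPGroup⟩
    have heq : chainNormalizer a = chainStabilizer s := by
      refine le_antisymm (le_chainStabilizer_iff.2 ⟨fun Q hQ ↦ ?_, fun Q hQ hQ' ↦
        absurd (h Q hQ) hQ'⟩) (le_iInf fun i ↦ chainStabilizer_le_normalizer (hmem i))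
      obtain ⟨i, rfl⟩ : Q ∈ Set.range a := hrange ▸ normalPart_subset hQ
      exact iInf_le _ i
    rw [← heq]
    exact ⟨_, IsSylowIn.of_isSylowSubgroup hS⟩

section Insert

variable {R : Subgroup G} (hR : IsSylowIn p (chainStabilizer s) R) (h : ¬ IsFull p s)

include hR h

omit hs h in
lemma _root_.IsSylowIn.lt_of_notMem_normalPart {P : Subgroup G} (hP : P ∈ s)
    (hP' : P ∉ normalPart s) : R < P := by
  refine lt_of_le_of_ne ((le_chainStabilizer_iff.1 hR.le).2 P hP hP') ?_
  rintro rfl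
  refine hP' (mem_normalPart.2 ⟨hP, fun Q hQ _ ↦ hR.le.trans (chainStabilizer_le_normalizer hQ)⟩)

lemma notMem_of_isSylowIn : R ∉ s := fun hRs ↦ by
  have h' : R ∉ normalPart s := fun hR' ↦
    (hs.normalTop_lt_of_not_isFull hR h).not_ge (le_normalTop hR')
  exact (hR.lt_of_notMem_normalPart hRs h').false

lemma comparable_of_isSylowIn {P : Subgroup G} (hP : P ∈ s) : P ≤ R ∨ R ≤ P := by
  by_cases hP' : P ∈ normalPart s
  · exact Or.inl ((le_normalTop hP').trans (hs.normalTop_lt_of_not_isFull hR h).le)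
  · exact Or.inr (hR.lt_of_notMem_normalPart hP hP').le

lemma insert : IsPChain p (insert R s) where
  nonempty := Finset.insert_nonempty _ _
  comparable := by
    intro P hP Q hQ
    rcases Finset.mem_insert.1 hP with rfl | hP' <;> rcases Finset.mem_insert.1 hQ with rfl | hQ'
    · exact Or.inl le_rfl
    · exact (hs.comparable_of_isSylowIn hR h hQ').symm
    · exact hs.comparable_of_isSylowIn hR h hP'
    · exact hs.comparable P hP' Q hQ'
  isFinitePSubgroup := by
    intro P hP
    rcases Finset.mem_insert.1 hP with rfl | hP
    · exact hR.toIsFinitePSubgroup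
    · exact hs.isFinitePSubgroup P hP

lemma normalPart_insert : normalPart (Insert.insert R s) = Insert.insert R (normalPart s) := by
  ext P
  rw [mem_normalPart, Finset.mem_insert, Finset.mem_insert]
  constructor
  · rintro ⟨rfl | hP, hP'⟩
    · exact Or.inl rfl
    · exact Or.inr (mem_normalPart.2 ⟨hP, fun Q hQ ↦ hP' Q (Finset.mem_insert_of_mem hQ)⟩)
  · rintro (rfl | hP)
    · refine ⟨Or.inl rfl, fun Q hQ _ ↦ ?_⟩
      rcases Finset.mem_insert.1 hQ with rfl | hQ
      · exact Subgroup.le_normalizer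
      · exact hR.le.trans (chainStabilizer_le_normalizer hQ)
    · refine ⟨Or.inr (normalPart_subset hP), fun Q hQ hQP ↦ ?_⟩
      rcases Finset.mem_insert.1 hQ with rfl | hQ
      · exact absurd (hQP.trans (le_normalTop hP)) (hs.normalTop_lt_of_not_isFull hR h).not_ge
      · exact (mem_normalPart.1 hP).2 Q hQ hQP

lemma normalTop_insert : normalTop (Insert.insert R s) = R := by
  have hp := hs.normalPart_insert hR h
  refine normalTop_eq (by rw [hp]; exact Finset.mem_insert_self _ _) fun Q hQ ↦ ?_
  rw [hp] at hQ
  rcases Finset.mem_insert.1 hQ with rfl | hQ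
  · exact le_rfl
  · exact (le_normalTop hQ).trans (hs.normalTop_lt_of_not_isFull hR h).le

/-- Adding a Sylow subgroup `R` of the stabilizer makes a chain full: the new stabilizer is
contained in the intersection of the old one with the normalizer of `R`. -/
lemma isFull_insert : IsFull p (Insert.insert R s) := by
  intro P hP hPs
  rw [hs.normalTop_insert hR h]
  have h₁ := le_chainStabilizer_iff.1 hPs
  rw [hs.normalPart_insert hR h] at h₁
  refine hR.le_of_le_normalizer hP (le_chainStabilizer_iff.2 ⟨fun Q hQ ↦
    h₁.1 Q (Finset.mem_insert_of_mem hQ), fun Q hQ hQ' ↦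
    h₁.2 Q (Finset.mem_insert_of_mem hQ) ?_⟩) (h₁.1 R (Finset.mem_insert_self _ _))
  rw [Finset.mem_insert, not_or]
  refine ⟨?_, hQ'⟩
  rintro rfl
  exact hs.notMem_of_isSylowIn hR h hQ

omit hs h in
/-- The last member of the normal part does not shrink along the other faces of the partner of a
chain. -/
lemma _root_.IsSylowIn.le_normalTop_erase_insert {P : Subgroup G} (hPR : P ≠ R) :
    R ≤ normalTop ((Insert.insert R s).erase P) := by
  refine le_normalTop (mem_normalPart.2 ⟨Finset.mem_erase.2
    ⟨hPR.symm, Finset.mem_insert_self _ _⟩, fun Q hQ hQR ↦ ?_⟩)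
  rcases Finset.mem_insert.1 (Finset.mem_of_mem_erase hQ) with rfl | hQ
  · exact Subgroup.le_normalizer
  · exact hR.le.trans (chainStabilizer_le_normalizer hQ)

end Insert

lemma of_subset {u : Finset (Subgroup G)} (hu : u ⊆ s) (hne : u.Nonempty) : IsPChain p u where
  nonempty := hne
  comparable P hP Q hQ := hs.comparable P (hu hP) Q (hu hQ)
  isFinitePSubgroup P hP := hs.isFinitePSubgroup P (hu hP)

section Erase

variable (h : IsFull p s) (hne : (s.erase (normalTop s)).Nonempty)

include h

/-- Removing the last member of the normal part of a full chain does not make further members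
normal: if `B` is the first member outside the normal part, then `N_B(t)`, where `t` is the last
member of the normal part, is larger than `t` and would lie in the stabilizer. -/
lemma normalPart_erase [Fact p.Prime] :
    normalPart (s.erase (normalTop s)) = (normalPart s).erase (normalTop s) := by
  ext P
  constructor
  · intro hP
    have hPs := Finset.mem_erase.1 (normalPart_subset hP)
    refine Finset.mem_erase.2 ⟨hPs.1, ?_⟩
    by_contra hP'
    obtain ⟨B, hB, hBmin⟩ := (s \ normalPart s).exists_ge_of_comparable
      ⟨P, Finset.mem_sdiff.2 ⟨hPs.2, hP'⟩⟩ fun x hx y hy ↦ hs.comparable x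
        (Finset.mem_sdiff.1 hx).1 y (Finset.mem_sdiff.1 hy).1
    obtain ⟨hBs, hB'⟩ := Finset.mem_sdiff.1 hB
    have hlt := hs.normalTop_lt hBs hB'
    have hBu : B ∈ normalPart (s.erase (normalTop s)) := normalPart_of_le hP
      (Finset.mem_erase.2 ⟨hlt.ne', hBs⟩) (hBmin P (Finset.mem_sdiff.2 ⟨hPs.2, hP'⟩))
    refine ((hs.isFinitePSubgroup B hBs).lt_normalizer_inf hlt).not_ge (h _
      ((hs.isFinitePSubgroup B hBs).mono inf_le_right) (le_chainStabilizer_iff.2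
        ⟨fun Q hQ ↦ ?_, fun Q hQ hQ' ↦ inf_le_right.trans
          (hBmin Q (Finset.mem_sdiff.2 ⟨hQ, hQ'⟩))⟩))
    by_cases hQt : Q = normalTop s
    · rw [hQt]
      exact inf_le_left
    · exact inf_le_right.trans ((mem_normalPart.1 hBu).2 Q
        (Finset.mem_erase.2 ⟨hQt, normalPart_subset hQ⟩) ((le_normalTop hQ).trans hlt.le))
  · intro hP
    obtain ⟨hPt, hP'⟩ := Finset.mem_erase.1 hP
    exact mem_normalPart.2 ⟨Finset.mem_erase.2 ⟨hPt, normalPart_subset hP'⟩,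
      fun Q hQ ↦ (mem_normalPart.1 hP').2 Q (Finset.mem_of_mem_erase hQ)⟩

lemma le_chainStabilizer_of_le_chainStabilizer_erase [Fact p.Prime] {H : Subgroup G}
    (hH : H ≤ chainStabilizer (s.erase (normalTop s)))
    (hH' : H ≤ Subgroup.normalizer (normalTop s : Set G)) : H ≤ chainStabilizer s := by
  rw [le_chainStabilizer_iff, hs.normalPart_erase h] at hH
  refine le_chainStabilizer_iff.2 ⟨fun Q hQ ↦ ?_, fun Q hQ hQ' ↦ ?_⟩
  · by_cases hQt : Q = normalTop s
    · rwa [hQt]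
    · exact hH.1 Q (Finset.mem_erase.2 ⟨hQt, hQ⟩)
  · exact hH.2 Q (Finset.mem_erase.2 ⟨(hs.normalTop_lt hQ hQ').ne', hQ⟩)
      fun h' ↦ hQ' (Finset.mem_of_mem_erase h')

lemma normalTop_le_chainStabilizer_erase [Fact p.Prime] :
    normalTop s ≤ chainStabilizer (s.erase (normalTop s)) := by
  rw [le_chainStabilizer_iff, hs.normalPart_erase h]
  have hle := le_chainStabilizer_iff.1 hs.normalTop_le_chainStabilizer
  exact ⟨fun Q hQ ↦ hle.1 Q (Finset.mem_of_mem_erase hQ), fun Q hQ hQ' ↦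
    hle.2 Q (Finset.mem_of_mem_erase hQ) fun h' ↦
      hQ' (Finset.mem_erase.2 ⟨(Finset.mem_erase.1 hQ).1, h'⟩)⟩

include hne in
lemma not_isFull_erase [Fact p.Prime] : ¬ IsFull p (s.erase (normalTop s)) := by
  intro hfull
  have hmem := (hs.of_subset (Finset.erase_subset _ _) hne).normalTop_mem
  rw [hs.normalPart_erase h] at hmem
  obtain ⟨hne', hmem⟩ := Finset.mem_erase.1 hmem
  exact hne' (le_antisymm (le_normalTop hmem) (hfull _ hs.normalTop_isFinitePSubgroup
    (hs.normalTop_le_chainStabilizer_erase h)))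

include hne in
/-- A full chain is obtained by adding a Sylow subgroup of the stabilizer to the chain without
the last member of its normal part. -/
lemma isSylowIn_erase [Fact p.Prime] (hG : IsPseudoFinite p G) :
    IsSylowIn p (chainStabilizer (s.erase (normalTop s))) (normalTop s) := by
  obtain ⟨R, hR⟩ := (hs.of_subset (Finset.erase_subset _ _) hne).exists_isSylowIn hG
  refine hR.of_maximal hs.normalTop_isFinitePSubgroup (hs.normalTop_le_chainStabilizer_erase h)
    fun Q hQ htQ hQu ↦ ?_
  by_contra hQt
  refine (hQ.lt_normalizer_inf (lt_of_le_of_ne htQ (Ne.symm hQt))).not_ge (h _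
    (hQ.mono inf_le_right) ?_)
  exact hs.le_chainStabilizer_of_le_chainStabilizer_erase h (inf_le_right.trans hQu) inf_le_left

end Erase

end IsPChain

/-! ### Singleton chains -/

lemma normalPart_singleton (P : Subgroup G) : normalPart {P} = {P} := by
  refine (Finset.subset_singleton_iff.1 normalPart_subset).resolve_left fun h ↦ ?_
  have : P ∈ normalPart {P} := mem_normalPart.2 ⟨Finset.mem_singleton_self P, fun Q hQ _ ↦ by
    rw [Finset.mem_singleton.1 hQ]
    exact Subgroup.le_normalizer⟩
  simp [h] at this

lemma normalTop_singleton (P : Subgroup G) : normalTop {P} = P := by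
  rw [normalTop, normalPart_singleton, Finset.sup_singleton, id]

lemma chainStabilizer_singleton (P : Subgroup G) :
    chainStabilizer {P} = Subgroup.normalizer (P : Set G) := by
  simp [chainStabilizer, normalPart_singleton]

/-- A singleton chain is full exactly if its member is a Sylow subgroup. -/
lemma isFull_singleton [Fact p.Prime] (hS : ∃ S : Subgroup G, IsSylowIn p ⊤ S)
    {P : Subgroup G} (hP : IsFinitePSubgroup p P) : IsFull p {P} ↔ IsSylowIn p ⊤ P := by
  rw [IsFull, normalTop_singleton, chainStabilizer_singleton]
  constructor
  · intro h
    obtain ⟨S, hS⟩ := hS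
    refine hS.of_maximal hP le_top fun Q hQ hPQ _ ↦ ?_
    by_contra hne
    exact (hQ.lt_normalizer_inf (lt_of_le_of_ne hPQ (Ne.symm hne))).not_ge
      (h _ (hQ.mono inf_le_right) inf_le_left)
  · intro h Q hQ hQP
    exact h.le_of_le_normalizer hQ le_top hQP

/-! ### Equivariance -/

variable {s : Finset (Subgroup G)} (a : MulAut G)

lemma smul_le_normalizer_smul_iff {P Q : Subgroup G} :
    a • P ≤ Subgroup.normalizer ((a • Q : Subgroup G) : Set G) ↔
      P ≤ Subgroup.normalizer (Q : Set G) := by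
  have key : Subgroup.normalizer ((a • Q : Subgroup G) : Set G) =
      a • Subgroup.normalizer (Q : Set G) :=
    (Subgroup.map_equiv_normalizer_eq Q a).symm
  rw [key, Subgroup.pointwise_smul_le_pointwise_smul_iff]

lemma normalPart_smul : normalPart (a • s) = a • normalPart s := by
  ext P
  obtain ⟨P, rfl⟩ : ∃ Q, P = a • Q := ⟨a⁻¹ • P, by simp⟩
  rw [Finset.smul_mem_smul_finset_iff, mem_normalPart, mem_normalPart,
    Finset.smul_mem_smul_finset_iff]
  refine and_congr_right fun _ ↦ ⟨fun h Q hQ hQP ↦ ?_, fun h Q hQ hQP ↦ ?_⟩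
  · exact (smul_le_normalizer_smul_iff a).1 (h _ (Finset.smul_mem_smul_finset hQ)
      (Subgroup.pointwise_smul_le_pointwise_smul_iff.2 hQP))
  · obtain ⟨Q, hQm, rfl⟩ := Finset.mem_smul_finset.1 hQ
    exact (smul_le_normalizer_smul_iff a).2 (h Q hQm
      (Subgroup.pointwise_smul_le_pointwise_smul_iff.1 hQP))

lemma smul_le_chainStabilizer_smul {H : Subgroup G} :
    a • H ≤ chainStabilizer (a • s) ↔ H ≤ chainStabilizer s := by
  rw [le_chainStabilizer_iff, le_chainStabilizer_iff, normalPart_smul]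
  constructor
  · exact fun h ↦ ⟨fun Q hQ ↦ (smul_le_normalizer_smul_iff a).1
      (h.1 _ (Finset.smul_mem_smul_finset hQ)), fun Q hQ hQ' ↦
      Subgroup.pointwise_smul_le_pointwise_smul_iff.1 (h.2 _ (Finset.smul_mem_smul_finset hQ)
        (by rwa [Finset.smul_mem_smul_finset_iff]))⟩
  · refine fun h ↦ ⟨fun Q hQ ↦ ?_, fun Q hQ hQ' ↦ ?_⟩ <;>
      obtain ⟨Q, hQm, rfl⟩ := Finset.mem_smul_finset.1 hQ
    · exact (smul_le_normalizer_smul_iff a).2 (h.1 Q hQm)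
    · exact Subgroup.pointwise_smul_le_pointwise_smul_iff.2 (h.2 Q hQm
        (by rwa [Finset.smul_mem_smul_finset_iff] at hQ'))

lemma chainStabilizer_smul : chainStabilizer (a • s) = a • chainStabilizer s := by
  refine le_antisymm ?_ ((smul_le_chainStabilizer_smul a).2 le_rfl)
  rw [Subgroup.subset_pointwise_smul_iff, ← smul_le_chainStabilizer_smul a, smul_inv_smul]

namespace IsPChain

lemma smul (hs : IsPChain p s) : IsPChain p (a • s) where
  nonempty := hs.nonempty.smul_finset
  comparable P hP Q hQ := by
    obtain ⟨P, hPm, rfl⟩ := Finset.mem_smul_finset.1 hP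
    obtain ⟨Q, hQm, rfl⟩ := Finset.mem_smul_finset.1 hQ
    simpa only [Subgroup.pointwise_smul_le_pointwise_smul_iff] using hs.comparable P hPm Q hQm
  isFinitePSubgroup P hP := by
    obtain ⟨P, hPm, rfl⟩ := Finset.mem_smul_finset.1 hP
    exact (hs.isFinitePSubgroup P hPm).smul a

lemma normalTop_smul (hs : IsPChain p s) : normalTop (a • s) = a • normalTop s := by
  refine normalTop_eq ?_ fun Q hQ ↦ ?_
  · rw [normalPart_smul]
    exact Finset.smul_mem_smul_finset hs.normalTop_mem
  · rw [normalPart_smul] at hQ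
    obtain ⟨Q, hQm, rfl⟩ := Finset.mem_smul_finset.1 hQ
    exact Subgroup.pointwise_smul_le_pointwise_smul_iff.2 (le_normalTop hQm)

lemma isFull_smul_iff (hs : IsPChain p s) : IsFull p (a • s) ↔ IsFull p s := by
  constructor
  · intro h P hP hPs
    have := h _ (hP.smul a) ((smul_le_chainStabilizer_smul a).2 hPs)
    rwa [hs.normalTop_smul, Subgroup.pointwise_smul_le_pointwise_smul_iff] at this
  · intro h P hP hPs
    obtain ⟨P, rfl⟩ : ∃ Q, P = a • Q := ⟨a⁻¹ • P, by simp⟩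
    rw [hs.normalTop_smul, Subgroup.pointwise_smul_le_pointwise_smul_iff]
    refine h P ?_ ((smul_le_chainStabilizer_smul a).1 hPs)
    simpa using hP.smul a⁻¹

end IsPChain

lemma IsSylowIn.conj_smul_conj_smul {K R : Subgroup G} (hR : IsSylowIn p K R) (g : G) :
    IsSylowIn p (MulAut.conj g • K) (MulAut.conj g • R) where
  toIsFinitePSubgroup := hR.smul _
  le := Subgroup.pointwise_smul_le_pointwise_smul_iff.2 hR.le
  conj_le P hP hPK := by
    obtain ⟨P, rfl⟩ : ∃ Q, P = MulAut.conj g • Q := ⟨(MulAut.conj g)⁻¹ • P, by simp⟩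
    obtain ⟨x, hx, h⟩ := hR.conj_le P (by simpa using hP.smul (MulAut.conj g)⁻¹)
      (Subgroup.pointwise_smul_le_pointwise_smul_iff.1 hPK)
    refine ⟨g * x * g⁻¹, Subgroup.smul_mem_pointwise_smul x (MulAut.conj g) K hx, ?_⟩
    rw [← mul_smul, ← map_mul, inv_mul_cancel_right, map_mul, mul_smul,
      Subgroup.pointwise_smul_le_pointwise_smul_iff]
    exact h

lemma IsSylowIn.conj_smul_finset {R : Subgroup G} (hR : IsSylowIn p (chainStabilizer s) R)
    (g : G) : IsSylowIn p (chainStabilizer (MulAut.conj g • s)) (MulAut.conj g • R) := by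
  rw [chainStabilizer_smul]
  exact hR.conj_smul_conj_smul g

end

end Chains

/-! ### Simplices of the orbit space as conjugacy classes of chains -/

namespace SSet

variable {G : Type u} [Group G] {X : SSet.{u}} (ρ : G →* End X)

lemma orbitMk_eq_iff {Δ : SimplexCategoryᵒᵖ} {x y : X.obj Δ} :
    orbitMk ρ x = orbitMk ρ y ↔ ∃ g : G, (End.asHom (ρ g)).app Δ x = y :=
  Quotient.eq (r := orbitSetoid ρ Δ)

lemma orbitMk_mem_degenerate_iff {n : ℕ} {x : X _⦋n⦌} :
    orbitMk ρ x ∈ (orbit ρ).degenerate n ↔ x ∈ X.degenerate n := by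
  constructor
  · rintro ⟨m, hm, f, y, hy⟩
    obtain ⟨y, rfl⟩ := Quotient.exists_rep y
    obtain ⟨g, rfl⟩ := (orbitMk_eq_iff ρ (x := X.map f.op y)).1 hy
    exact degenerate_app_apply ⟨m, hm, f, y, rfl⟩ _
  · rintro ⟨m, hm, f, y, rfl⟩
    exact ⟨m, hm, f, orbitMk ρ y, rfl⟩

end SSet

section Represents

variable {G : Type u} [Group G] {C : Set (Subgroup G)}
  {hC : ∀ P ∈ C, ∀ g : G, MulAut.conj g • P ∈ C}

/-- The set `s` is the set of members of a strict chain whose orbit is the simplex `x`. Such an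
`s` exists only if `x` is nondegenerate, and it is then unique up to conjugation. -/
def Represents {n : ℕ} (s : Finset (Subgroup G)) (x : orbitNerve C hC _⦋n⦌) : Prop :=
  ∃ y : nerve C _⦋n⦌, StrictMono y.obj ∧ SSet.orbitMk (conjAction C hC) y = x ∧
    Set.range (fun i ↦ (y.obj i).1) = (s : Set (Subgroup G))

open scoped Classical in
lemma exists_represents_iff {n : ℕ} {x : orbitNerve C hC _⦋n⦌} :
    (∃ s, Represents s x) ↔ x ∈ (orbitNerve C hC).nonDegenerate n := by
  constructor
  · rintro ⟨s, y, hy, rfl, -⟩ h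
    exact (PartialOrder.mem_nerve_nonDegenerate_iff_strictMono y).2 hy
      ((SSet.orbitMk_mem_degenerate_iff _).1 h)
  · intro hx
    obtain ⟨y, rfl⟩ := Quotient.exists_rep x
    refine ⟨Finset.univ.image fun i ↦ (y.obj i).1, y,
      (PartialOrder.mem_nerve_nonDegenerate_iff_strictMono y).1 fun h ↦
        hx ((SSet.orbitMk_mem_degenerate_iff _).2 h), rfl, by simp⟩

lemma represents_singleton (P : C) : Represents {P.1} (orbitVertex C hC P) := by
  refine ⟨nerveEquiv.symm P, Subsingleton.strictMono (α := Fin 1) _, rfl, ?_⟩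
  rw [Finset.coe_singleton]
  exact Set.range_const (ι := Fin 1) (c := P.1)

namespace Represents

variable {n : ℕ} {s s' : Finset (Subgroup G)} {x x' : orbitNerve C hC _⦋n⦌}

lemma mem (h : Represents s x) {P : Subgroup G} (hP : P ∈ s) : P ∈ C := by
  obtain ⟨y, -, -, hs⟩ := h
  rw [← Finset.mem_coe, ← hs] at hP
  obtain ⟨i, rfl⟩ := hP
  exact (y.obj i).2

lemma card_eq (h : Represents s x) : s.card = n + 1 := by
  obtain ⟨y, hy, -, hs⟩ := h
  have := Nat.card_range_of_injective (Subtype.val_injective.comp hy.injective)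
  rw [← Set.ncard_coe_finset, ← hs]
  exact this.trans (Nat.card_eq_fintype_card.trans (Fintype.card_fin _))

lemma isPChain {p : ℕ} (hC' : IsClosedCollection p C) (h : Represents s x) : IsPChain p s where
  nonempty := Finset.card_ne_zero.1 (by rw [h.card_eq]; exact n.succ_ne_zero)
  comparable P hP Q hQ := by
    obtain ⟨y, hy, -, hs⟩ := h
    rw [← Finset.mem_coe, ← hs] at hP
    obtain ⟨i, rfl⟩ := hP
    rw [← Finset.mem_coe, ← hs] at hQ
    obtain ⟨j, rfl⟩ := hQ
    exact (le_total i j).imp (fun hij ↦ hy.monotone hij) fun hij ↦ hy.monotone hij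
  isFinitePSubgroup P hP := ⟨hC'.finite P (h.mem hP), hC'.isPGroup P (h.mem hP)⟩

open scoped Classical in
lemma conj_smul (h : Represents s x) (g : G) : Represents (MulAut.conj g • s) x := by
  obtain ⟨y, hy, rfl, hs⟩ := h
  refine ⟨(End.asHom (conjAction C hC g)).app _ y, fun i j hij ↦ ?_,
    ((SSet.orbitMk_eq_iff _).2 ⟨g, rfl⟩).symm, ?_⟩
  · have h := hy hij
    refine lt_of_le_not_ge (Subgroup.pointwise_smul_le_pointwise_smul_iff.2 h.le) fun h' ↦ ?_
    exact h.not_ge (Subgroup.pointwise_smul_le_pointwise_smul_iff.1 h')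
  · rw [Finset.coe_smul_finset, ← hs, Set.smul_set_range]
    rfl

open scoped Classical in
lemma exists_conj_smul_eq (h : Represents s x) (h' : Represents s' x) :
    ∃ g : G, MulAut.conj g • s = s' := by
  obtain ⟨y, hy, rfl, hs⟩ := h
  obtain ⟨y', hy', hyy', hs'⟩ := h'
  obtain ⟨g, rfl⟩ := (SSet.orbitMk_eq_iff _).1 hyy'.symm
  refine ⟨g, Finset.coe_injective ?_⟩
  rw [Finset.coe_smul_finset, ← hs, ← hs', Set.smul_set_range]
  rfl

lemma unique (h : Represents s x) (h' : Represents s x') : x = x' := by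
  obtain ⟨y, hy, rfl, hs⟩ := h
  obtain ⟨y', hy', rfl, hs'⟩ := h'
  refine congrArg _ (nerve.ext_of_isThin ?_)
  have hval : StrictMono (Subtype.val : C → Subgroup G) := fun _ _ h ↦ h
  have := (StrictMono.range_inj (hval.comp hy) (hval.comp hy')).1 (hs.trans hs'.symm)
  exact funext fun i ↦ Subtype.val_injective (congrFun this i)

open scoped Classical in
/-- The faces of a simplex are represented by the sets obtained by removing one member. -/
lemma exists_faces {x : orbitNerve C hC _⦋n + 1⦌} (h : Represents s x) :
    ∃ a : Fin (n + 2) → Subgroup G, Function.Injective a ∧ Set.range a = s ∧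
      ∀ j, Represents (s.erase (a j)) ((orbitNerve C hC).δ j x) := by
  obtain ⟨y, hy, rfl, hs⟩ := h
  refine ⟨fun i ↦ (y.obj i).1, Subtype.val_injective.comp hy.injective, hs, fun j ↦
    ⟨(nerve C).δ j y, hy.comp (Fin.strictMono_succAbove j), rfl, ?_⟩⟩
  rw [Finset.coe_erase, ← hs]
  ext P
  constructor
  · rintro ⟨i, rfl⟩
    exact ⟨⟨_, rfl⟩, fun h ↦ Fin.succAbove_ne j i
      ((Subtype.val_injective.comp hy.injective) h)⟩
  · rintro ⟨⟨i, rfl⟩, hi⟩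
    obtain ⟨k, rfl⟩ := Fin.exists_succAbove_eq (x := i) (y := j)
      fun h ↦ hi (by subst h; exact Set.mem_singleton _)
    exact ⟨k, rfl⟩

end Represents

/-- Every chain in `C` represents a simplex. -/
lemma exists_represents (hC : ∀ P ∈ C, ∀ g : G, MulAut.conj g • P ∈ C) {n : ℕ}
    {s : Finset (Subgroup G)} (hs : ∀ P ∈ s, P ∈ C) (hn : s.card = n + 1)
    (h : ∀ P ∈ s, ∀ Q ∈ s, P ≤ Q ∨ Q ≤ P) : ∃ x : orbitNerve C hC _⦋n⦌, Represents s x := by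
  obtain ⟨a, ha, hrange⟩ := Finset.exists_strictMono_of_comparable hn h
  have hmem (i : Fin (n + 1)) : a i ∈ C := hs _ (by
    rw [← Finset.mem_coe, ← hrange]
    exact ⟨i, rfl⟩)
  have hb : StrictMono fun i ↦ (⟨a i, hmem i⟩ : C) := fun i j hij ↦ ha hij
  exact ⟨SSet.orbitMk _ (Δ := op ⦋n⦌) hb.monotone.functor, hb.monotone.functor, hb, rfl, hrange⟩

end Represents

/-! ### The matching -/

section Matching

variable {G : Type u} [Group G] {p : ℕ}

lemma IsPseudoFinite.exists_isSylowSubgroup (hG : IsPseudoFinite p G) :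
    ∃ S : Subgroup G, IsSylowSubgroup p S := by
  -- The normalizer of the one-term chain consisting of the trivial subgroup is `G`.
  obtain ⟨S, hS⟩ := hG 0 (fun _ ↦ ⊥) monotone_const fun _ ↦ ⟨inferInstance, IsPGroup.of_bot⟩
  have htop : chainNormalizer (fun _ : Fin (0 + 1) ↦ (⊥ : Subgroup G)) = ⊤ := by
    rw [chainNormalizer, ciInf_const]
    exact Subgroup.normalizer_eq_top (H := (⊥ : Subgroup G))
  have h := IsSylowIn.of_isSylowSubgroup hS
  generalize S.map (chainNormalizer _).subtype = S' at h
  rw [htop] at h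
  exact ⟨S', h.isSylowSubgroup⟩

lemma IsClosedCollection.mem_of_isSylowSubgroup {C : Set (Subgroup G)}
    (hC : IsClosedCollection p C) (hne : C.Nonempty) {S : Subgroup G}
    (hS : IsSylowSubgroup p S) : S ∈ C := by
  obtain ⟨P, hP⟩ := hne
  obtain ⟨g, hg⟩ := hS.conj_le P (hC.finite P hP) (hC.isPGroup P hP)
  exact hC.overgroup_mem _ (hC.conj_mem P hP g) S hg hS.finite hS.isPGroup

open scoped Classical

namespace IsClosedCollection

variable {C : Set (Subgroup G)} (hC : IsClosedCollection p C) {n : ℕ}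

include hC in
lemma isFull_iff_of_represents {s s' : Finset (Subgroup G)}
    {x : orbitNerve C hC.conj_mem _⦋n⦌} (h : Represents s x) (h' : Represents s' x) :
    IsFull p s ↔ IsFull p s' := by
  obtain ⟨g, rfl⟩ := h.exists_conj_smul_eq h'
  exact ((h.isPChain hC).isFull_smul_iff _).symm

/-- The redundant cells: the orbits of the chains that are not full. -/
def redundant (n : ℕ) : Set (orbitNerve C hC.conj_mem _⦋n⦌) :=
  {x | ∃ s, Represents s x ∧ ¬ IsFull p s}

/-- The cells that are not redundant: the orbits of the full chains. -/
def full (n : ℕ) : Set (orbitNerve C hC.conj_mem _⦋n⦌) :=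
  {x | ∃ s, Represents s x ∧ IsFull p s}

lemma disjoint_full_redundant : Disjoint (hC.full n) (hC.redundant n) :=
  Set.disjoint_left.2 fun _ ⟨_, h, hs⟩ ⟨_, h', hs'⟩ ↦
    hs' ((hC.isFull_iff_of_represents h h').1 hs)

lemma full_union_redundant :
    hC.full n ∪ hC.redundant n = (orbitNerve C hC.conj_mem).nonDegenerate n := by
  ext x
  rw [← exists_represents_iff]
  constructor
  · rintro (⟨s, hs, -⟩ | ⟨s, hs, -⟩) <;> exact ⟨s, hs⟩
  · rintro ⟨s, hs⟩
    by_cases h : IsFull p s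
    · exact Or.inl ⟨s, hs, h⟩
    · exact Or.inr ⟨s, hs, h⟩

/-- The cell `σ` arises from the redundant cell `τ` by adding to a chain representing `τ` a Sylow
subgroup of its stabilizer. -/
def IsPartner (τ : orbitNerve C hC.conj_mem _⦋n⦌) (σ : orbitNerve C hC.conj_mem _⦋n + 1⦌) : Prop :=
  ∃ (s : Finset (Subgroup G)) (R : Subgroup G), Represents s τ ∧ ¬ IsFull p s ∧
    IsSylowIn p (chainStabilizer s) R ∧ Represents (insert R s) σ

lemma exists_isPartner (hG : IsPseudoFinite p G) {τ : orbitNerve C hC.conj_mem _⦋n⦌}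
    (hτ : τ ∈ hC.redundant n) : ∃ σ, hC.IsPartner τ σ := by
  obtain ⟨s, hs, hfull⟩ := hτ
  have hsp := hs.isPChain hC
  obtain ⟨R, hR⟩ := hsp.exists_isSylowIn hG
  have hRC : R ∈ C := hC.overgroup_mem _ (hs.mem hsp.normalTop_mem') R
    (hsp.normalTop_le_of_isSylowIn hR) hR.finite hR.isPGroup
  obtain ⟨σ, hσ⟩ := exists_represents (n := n + 1) hC.conj_mem (s := insert R s)
    (fun P hP ↦ by
      rcases Finset.mem_insert.1 hP with rfl | hP
      · exact hRC
      · exact hs.mem hP)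
    (by rw [Finset.card_insert_of_notMem (hsp.notMem_of_isSylowIn hR hfull), hs.card_eq])
    (hsp.insert hR hfull).comparable
  exact ⟨σ, s, R, hs, hfull, hR, hσ⟩

lemma exists_isPartner_right [Fact p.Prime] (hG : IsPseudoFinite p G)
    {σ : orbitNerve C hC.conj_mem _⦋n + 1⦌} (hσ : σ ∈ hC.full (n + 1)) :
    ∃ τ, hC.IsPartner τ σ := by
  obtain ⟨s, hs, hfull⟩ := hσ
  have hsp := hs.isPChain hC
  have hcard : (s.erase (normalTop s)).card = n + 1 := by
    rw [Finset.card_erase_of_mem hsp.normalTop_mem', hs.card_eq, Nat.add_sub_cancel]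
  have hne : (s.erase (normalTop s)).Nonempty :=
    Finset.card_ne_zero.1 (by rw [hcard]; exact n.succ_ne_zero)
  obtain ⟨τ, hτ⟩ := exists_represents hC.conj_mem
    (fun P hP ↦ hs.mem (Finset.mem_of_mem_erase hP)) hcard
    (hsp.of_subset (Finset.erase_subset _ _) hne).comparable
  refine ⟨τ, s.erase (normalTop s), normalTop s, hτ, hsp.not_isFull_erase hfull hne,
    hsp.isSylowIn_erase hfull hne hG, ?_⟩
  rwa [Finset.insert_erase hsp.normalTop_mem']

/-- The order of the last member of the normal part of a chain representing a cell. -/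
noncomputable def normalOrder (x : orbitNerve C hC.conj_mem _⦋n⦌) : ℕ :=
  if h : ∃ s, Represents s x then Nat.card (normalTop h.choose) else 0

lemma normalOrder_eq {s : Finset (Subgroup G)} {x : orbitNerve C hC.conj_mem _⦋n⦌}
    (h : Represents s x) : hC.normalOrder x = Nat.card (normalTop s) := by
  have hex : ∃ s, Represents s x := ⟨s, h⟩
  rw [normalOrder, dif_pos hex]
  obtain ⟨g, hg⟩ := h.exists_conj_smul_eq hex.choose_spec
  rw [← hg, (h.isPChain hC).normalTop_smul, card_smul]

lemma normalOrder_le {S : Subgroup G} (hS : IsSylowSubgroup p S)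
    (x : orbitNerve C hC.conj_mem _⦋n⦌) : hC.normalOrder x ≤ Nat.card S := by
  by_cases hex : ∃ s, Represents s x
  · obtain ⟨s, hs⟩ := hex
    have hfin := (hs.isPChain hC).normalTop_isFinitePSubgroup
    obtain ⟨g, hg⟩ := hS.conj_le _ hfin.finite hfin.isPGroup
    have := hS.finite
    rw [hC.normalOrder_eq hs, ← card_smul (MulAut.conj g)]
    exact Subgroup.card_le_of_le hg
  · rw [normalOrder, dif_neg hex]
    exact Nat.zero_le _

namespace IsPartner

variable {hC} {τ τ' : orbitNerve C hC.conj_mem _⦋n⦌} {σ σ' : orbitNerve C hC.conj_mem _⦋n + 1⦌}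

lemma mem_redundant (h : hC.IsPartner τ σ) : τ ∈ hC.redundant n := by
  obtain ⟨s, R, hs, hfull, -, -⟩ := h
  exact ⟨s, hs, hfull⟩

lemma mem_full (h : hC.IsPartner τ σ) : σ ∈ hC.full (n + 1) := by
  obtain ⟨s, R, hs, hfull, hR, hσ⟩ := h
  exact ⟨_, hσ, (hs.isPChain hC).isFull_insert hR hfull⟩

/-- Two Sylow subgroups of the stabilizer of a chain are conjugate by an element that fixes all
members of the chain, so the partner does not depend on choices. -/
lemma right_unique (h : hC.IsPartner τ σ) (h' : hC.IsPartner τ σ') : σ = σ' := by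
  obtain ⟨s, R, hs, hfull, hR, hσ⟩ := h
  obtain ⟨s', R', hs', hfull', hR', hσ'⟩ := h'
  obtain ⟨g, rfl⟩ := hs.exists_conj_smul_eq hs'
  obtain ⟨k, hk, rfl⟩ := (hR.conj_smul_finset g).exists_conj_eq hR'
  have hks : MulAut.conj k • (MulAut.conj g • s) = MulAut.conj g • s :=
    (Finset.image_congr fun P hP ↦ conj_smul_eq_of_mem_chainStabilizer hk hP).trans
      Finset.image_id
  have hσk := (hσ.conj_smul g).conj_smul k
  rw [Finset.smul_finset_insert, Finset.smul_finset_insert, hks] at hσk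
  exact hσk.unique hσ'

lemma left_unique (h : hC.IsPartner τ σ) (h' : hC.IsPartner τ' σ) : τ = τ' := by
  obtain ⟨s, R, hs, hfull, hR, hσ⟩ := h
  obtain ⟨s', R', hs', hfull', hR', hσ'⟩ := h'
  have hsp := hs.isPChain hC
  have hsp' := hs'.isPChain hC
  obtain ⟨g, hg⟩ := hσ.exists_conj_smul_eq hσ'
  have hRR' : MulAut.conj g • R = R' := by
    have := (hsp.insert hR hfull).normalTop_smul (MulAut.conj g)
    rwa [hg, hsp.normalTop_insert hR hfull, hsp'.normalTop_insert hR' hfull', eq_comm] at this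
  have hss' : MulAut.conj g • s = s' := by
    rw [← Finset.erase_insert (hsp'.notMem_of_isSylowIn hR' hfull'), ← hg, ← hRR',
      Finset.smul_finset_insert, Finset.erase_insert]
    rw [Finset.smul_mem_smul_finset_iff]
    exact hsp.notMem_of_isSylowIn hR hfull
  exact (hss' ▸ hs.conj_smul g).unique hs'

lemma normalOrder_lt (h : hC.IsPartner τ σ) : hC.normalOrder τ < hC.normalOrder σ := by
  obtain ⟨s, R, hs, hfull, hR, hσ⟩ := h
  have hsp := hs.isPChain hC
  rw [hC.normalOrder_eq hs, hC.normalOrder_eq hσ, hsp.normalTop_insert hR hfull]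
  have := hR.finite
  by_contra! hle
  have hlt := hsp.normalTop_lt_of_not_isFull hR hfull
  exact hlt.ne (Subgroup.eq_of_le_of_card_ge hlt.le hle)

/-- Exactly one face of `σ` is the cell `τ` of which `σ` is the partner; along the other faces,
the order of the last member of the normal part does not drop. -/
lemma exists_face (h : hC.IsPartner τ σ) : ∃ i, (orbitNerve C hC.conj_mem).δ i σ = τ ∧
    ∀ j ≠ i, hC.normalOrder σ ≤ hC.normalOrder ((orbitNerve C hC.conj_mem).δ j σ) := by
  obtain ⟨s, R, hs, hfull, hR, hσ⟩ := h
  have hsp := hs.isPChain hC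
  obtain ⟨a, ha, hrange, hface⟩ := hσ.exists_faces
  obtain ⟨i, rfl⟩ : R ∈ Set.range a := by
    rw [hrange]
    exact Finset.mem_insert_self _ _
  refine ⟨i, ?_, fun j hj ↦ ?_⟩
  · have := hface i
    rw [Finset.erase_insert (hsp.notMem_of_isSylowIn hR hfull)] at this
    exact this.unique hs
  · rw [hC.normalOrder_eq hσ, hC.normalOrder_eq (hface j), hsp.normalTop_insert hR hfull]
    have := ((hface j).isPChain hC).normalTop_isFinitePSubgroup.finite
    exact Subgroup.card_le_of_le (hR.le_normalTop_erase_insert (ha.ne hj))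

lemma normalOrder_le_of_ne (h : hC.IsPartner τ σ) {i j : Fin (n + 2)}
    (hi : (orbitNerve C hC.conj_mem).δ i σ = τ) (hj : j ≠ i) :
    hC.normalOrder σ ≤ hC.normalOrder ((orbitNerve C hC.conj_mem).δ j σ) := by
  obtain ⟨i', -, h'⟩ := h.exists_face
  obtain rfl : i = i' := by
    by_contra hne
    have := h' i hne
    rw [hi] at this
    exact this.not_gt h.normalOrder_lt
  exact h' j hj

end IsPartner

variable [Fact p.Prime] (hG : IsPseudoFinite p G)

/-- Passage to the partner, as a bijection from the redundant cells to the full cells of positive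
dimension. -/
noncomputable def partnerEquiv (n : ℕ) : hC.redundant n ≃ hC.full (n + 1) :=
  .ofBijective (fun τ ↦ ⟨_, (hC.exists_isPartner hG τ.2).choose_spec.mem_full⟩) <| by
    constructor
    · intro τ τ' h
      have h₁ := (hC.exists_isPartner hG τ.2).choose_spec
      have h₂ := (hC.exists_isPartner hG τ'.2).choose_spec
      have heq : (hC.exists_isPartner hG τ.2).choose = (hC.exists_isPartner hG τ'.2).choose :=
        congrArg Subtype.val h
      rw [← heq] at h₂
      exact Subtype.ext (h₁.left_unique h₂)
    · intro σ
      obtain ⟨τ, hτ⟩ := hC.exists_isPartner_right hG σ.2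
      exact ⟨⟨τ, hτ.mem_redundant⟩, Subtype.ext
        ((hC.exists_isPartner hG hτ.mem_redundant).choose_spec.right_unique hτ)⟩

lemma isPartner_partnerEquiv (τ : hC.redundant n) : hC.IsPartner τ.1 (hC.partnerEquiv hG n τ).1 :=
  (hC.exists_isPartner hG τ.2).choose_spec

/-- The matching of a cell with its partner. The full cells of dimension `0` are critical, all
other full cells are collapsible. -/
noncomputable def matchingData : SSet.MatchingData (orbitNerve C hC.conj_mem) where
  critical n := match n with
    | 0 => hC.full 0
    | _ + 1 => ∅
  redundant := hC.redundant
  collapsible n := match n with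
    | 0 => ∅
    | n + 1 => hC.full (n + 1)
  union_eq n := by
    rw [← hC.full_union_redundant]
    cases n
    · exact Set.union_empty _
    · rw [Set.empty_union, Set.union_comm]
  disjoint_critical_redundant n := by
    cases n
    · exact hC.disjoint_full_redundant
    · exact Set.empty_disjoint _
  disjoint_critical_collapsible n := by
    cases n
    · exact Set.disjoint_empty _
    · exact Set.empty_disjoint _
  disjoint_redundant_collapsible n := by
    cases n
    · exact Set.disjoint_empty _
    · exact hC.disjoint_full_redundant.symm
  c := hC.partnerEquiv hG
  collapsible_zero := rfl
  ι n τ := (hC.isPartner_partnerEquiv hG τ).exists_face.choose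
  δ_ι n τ := (hC.isPartner_partnerEquiv hG τ).exists_face.choose_spec.1

/-- A rank that decreases along the edges of the matching, for `B` a bound for the orders of the
finite `p`-subgroups: the first component is the dimension of the redundant cell of a matched
pair, the second one measures the order of the last member of the normal part. -/
noncomputable def edgeRank (B : ℕ) (x : (n : ℕ) × orbitNerve C hC.conj_mem _⦋n⦌) : ℕ ×ₗ ℕ :=
  if x.2 ∈ hC.redundant x.1 then toLex (x.1, 2 * (B - hC.normalOrder x.2))
  else toLex (x.1 - 1, 2 * (B - hC.normalOrder x.2) + 1)

omit [Fact p.Prime] in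
lemma edgeRank_of_mem_redundant (B : ℕ) {x : orbitNerve C hC.conj_mem _⦋n⦌}
    (hx : x ∈ hC.redundant n) :
    hC.edgeRank B ⟨n, x⟩ = toLex (n, 2 * (B - hC.normalOrder x)) :=
  if_pos hx

omit [Fact p.Prime] in
lemma edgeRank_of_mem_full (B : ℕ) {x : orbitNerve C hC.conj_mem _⦋n⦌} (hx : x ∈ hC.full n) :
    hC.edgeRank B ⟨n, x⟩ = toLex (n - 1, 2 * (B - hC.normalOrder x) + 1) :=
  if_neg fun h ↦ Set.disjoint_left.1 hC.disjoint_full_redundant hx h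

lemma edgeRank_lt {S : Subgroup G} (hS : IsSylowSubgroup p S)
    {x y : (n : ℕ) × orbitNerve C hC.conj_mem _⦋n⦌} (h : (hC.matchingData hG).Edge x y) :
    hC.edgeRank (Nat.card S) y < hC.edgeRank (Nat.card S) x := by
  induction h with
  | @up n τ =>
    have hp := hC.isPartner_partnerEquiv hG τ
    have h₁ := hp.normalOrder_lt
    have h₂ := hC.normalOrder_le hS (hC.partnerEquiv hG n τ).1
    rw [hC.edgeRank_of_mem_redundant _ hp.mem_redundant]
    refine (hC.edgeRank_of_mem_full _ hp.mem_full).trans_lt ?_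
    rw [Prod.Lex.toLex_lt_toLex]
    exact Or.inr ⟨rfl, by dsimp only; omega⟩
  | @down n σ j hj hmem =>
    obtain ⟨τ, rfl⟩ := (hC.partnerEquiv hG n).surjective σ
    have hp := hC.isPartner_partnerEquiv hG τ
    replace hj : j ≠ (hC.matchingData hG).ι n τ := by
      refine hj.trans_eq (congrArg _ ?_)
      exact (hC.partnerEquiv hG n).symm_apply_apply τ
    have hle := hp.normalOrder_le_of_ne ((hC.matchingData hG).δ_ι n τ) hj
    refine lt_of_lt_of_eq ?_ (hC.edgeRank_of_mem_full _ hp.mem_full).symm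
    rcases hmem with hmem | hmem
    · refine (hC.edgeRank_of_mem_redundant _ hmem).trans_lt ?_
      rw [Prod.Lex.toLex_lt_toLex]
      exact Or.inr ⟨rfl, by dsimp only; omega⟩
    · obtain _ | n := n
      · exact hmem.elim
      · refine (hC.edgeRank_of_mem_full _ hmem).trans_lt ?_
        rw [Prod.Lex.toLex_lt_toLex]
        exact Or.inl (Nat.lt_succ_self n)

/-- The Morse matching on the orbit space of a closed collection of `p`-subgroups. -/
noncomputable def morseMatching : SSet.MorseMatching (orbitNerve C hC.conj_mem) where
  toMatchingData := hC.matchingData hG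
  no_infinite_path := by
    rintro ⟨f, hf⟩
    obtain ⟨S, hS⟩ := hG.exists_isSylowSubgroup
    obtain ⟨k, hk⟩ := WellFounded.not_rel_apply_succ (r := (· < ·))
      fun k ↦ hC.edgeRank (Nat.card S) (f k)
    exact hk (hC.edgeRank_lt hG hS (hf k))

lemma critical_zero_eq {S : Subgroup G} (hS : IsSylowSubgroup p S) (hSC : S ∈ C) :
    (hC.morseMatching hG).critical 0 = {orbitVertex C hC.conj_mem ⟨S, hSC⟩} := by
  have hrep := represents_singleton (hC := hC.conj_mem) ⟨S, hSC⟩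
  ext x
  constructor
  · rintro ⟨s, hs, hfull⟩
    obtain ⟨P, rfl⟩ := Finset.card_eq_one.1 hs.card_eq
    have hP := (isFull_singleton ⟨S, hS.isSylowIn_top⟩
      ((hs.isPChain hC).isFinitePSubgroup P (Finset.mem_singleton_self P))).1 hfull
    obtain ⟨g, -, rfl⟩ := hP.exists_conj_eq hS.isSylowIn_top
    have := hs.conj_smul g
    rw [Finset.smul_finset_singleton] at this
    exact this.unique hrep
  · rintro rfl
    exact ⟨_, hrep, (isFull_singleton ⟨S, hS.isSylowIn_top⟩
      hS.isSylowIn_top.toIsFinitePSubgroup).2 hS.isSylowIn_top⟩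

end IsClosedCollection

end Matching

theorem theorem3p2 (p : ℕ) [Fact p.Prime] (G : Type u) [Group G] :
    (Finite G → IsPseudoFinite p G) ∧
    (IsPseudoFinite p G →
      ∀ (C : Set (Subgroup G)) (hC : IsClosedCollection p C), C.Nonempty →
        (∃ S : Subgroup G, IsSylowSubgroup p S) ∧
        (∃ M : SSet.MorseMatching (orbitNerve C hC.conj_mem),
          (∀ S : Subgroup G, IsSylowSubgroup p S →
            ∃ hS : S ∈ C, M.critical 0 = {orbitVertex C hC.conj_mem ⟨S, hS⟩}) ∧
          (∀ n : ℕ, 0 < n → M.critical n = ∅)) ∧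
        ContractibleSpace (SSet.toTop.obj (orbitNerve C hC.conj_mem))) := by
  refine ⟨fun _ ↦ isPseudoFinite_of_finite, fun hG C hC hne ↦ ?_⟩
  obtain ⟨S, hS⟩ := hG.exists_isSylowSubgroup
  have hpos : ∀ n : ℕ, 0 < n → (hC.morseMatching hG).critical n = ∅ := by
    rintro (_ | n) hn
    · exact absurd hn (lt_irrefl 0)
    · rfl
  exact ⟨⟨S, hS⟩, ⟨hC.morseMatching hG, fun S hS ↦ ⟨hC.mem_of_isSylowSubgroup hne hS,
    hC.critical_zero_eq hG hS _⟩, hpos⟩, (hC.morseMatching hG).contractibleSpace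
      (hC.critical_zero_eq hG hS (hC.mem_of_isSylowSubgroup hne hS)) hpos⟩
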